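/- **Model.** Let $F$ be (the distribution function of) a probability distribution on $[0,1]$ and $F^{-1}(q)=\inf\{v\in[0,1]: F(v)\ge q\}$ for $q\in[0,1]$. Candidates $t=1,\dots,T$ have i.i.d. abilities $\theta_t\sim F$; independently of these, $U_1,\dots,U_T$ are i.i.d. uniform on $[0,1]$ (available for randomization). A feasible online policy $\pi$ with budget $B$ is a sequence of decisions $\mu_t^\pi\in\{0,1\}$, measurable with respect to $\sigma(\theta_1,U_1,\dots,\theta_t,U_t)$, with $\sum_{t\le T}\mu^\pi_t\le B$ almost surely. Its regret is $$\mathrm{Regret}(B,T;\pi)=\mathbb E\Big[\max\Big\{\sum_{t\in S}\theta_t: S\subseteq\{1,\dots,T\},\ |S|\le B\Big\}\Big]-\mathbb E\Big[\sum_{t=1}^T\theta_t\mu_t^\pi\Big].$$ **Clustered distributions.** For $\beta\in[0,\infty)$, $\varepsilon_0\in(0,1]$, $\delta\in[0,1]$, the distribution $F$ is $(\beta,\varepsilon_0,\delta)$-clustered with gap quantiles $0=q_0^\star<q_1^\star<\dots<q_n^\star<q_{n+1}^\star=1$ ($n\ge 0$) if for every $i\in\{1,\dots,n+1\}$: (a)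 $|F^{-1}(q)-F^{-1}(\tilde q)|\le|q-\tilde q|^{1/(\beta+1)}+\delta$ for all $q,\tilde q\in(q^\star_{i-1},q^\star_i]$; (b) $q_i^\star-q_{i-1}^\star\ge\varepsilon_0$. **The CwG policy** (conservative with respect to gaps), for given $T$, $B$, $F$, $\varepsilon_0$ and gap quantiles. Let $B_t$ be the budget remaining after $t$ periods, $B_0=B$, $p^{\mathrm{ce}}_t=1-B_t/(T-t)$ and $\tilde T=\max\{0,\,T-\lfloor 16\log(1/\varepsilon_0)/\varepsilon_0^2\rfloor\}$. At time $t\in\{1,\dots,T\}$ draw $X_t$ uniformly from the interval $\{q\in[0,1]:F^{-1}(q)=\theta_t\}$ (using $U_t$), and hire candidate $t$ if and only if $B_{t-1}>0$ and $X_t\ge p_{t-1}$. The threshold $p_{t-1}$ is as follows. - If $t\le\tilde T$, let $\mathcal S_{t-1}$ be the set of $i\in\{1,\dots,n\}$ with $|p^{\mathrm{ce}}_{t-1}-q_i^\star|<\sqrt{2\log(T-t+1)/(T-t+1)}$. If $\mathcal S_{t-1}=\emptyset$, then $p_{t-1}=p^{\mathrm{ce}}_{t-1}$. Otherwise $p_{t-1}=q_j^\star$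 for some $j\in\mathcal S_{t-1}$ that minimizes $|p^{\mathrm{ce}}_{t-1}-q_j^\star|$ (ties broken by any fixed rule depending on the time and the remaining budget). - If $t>\tilde T$, then $p_{t-1}=p^{\mathrm{ce}}_{\tilde T}$. **Theorem.** There is a universal constant $C<\infty$ such that the following holds. Let $\beta\in[0,\infty)$, $\varepsilon_0\in(0,1]$, $\delta\in[0,1]$, and let $F$ be $(\beta,\varepsilon_0,\delta)$-clustered with gap quantiles $q_0^\star,\dots,q_{n+1}^\star$. Then for all $T\in\mathbb N$ and all $B\in\{1,\dots,T\}$, CwG is a feasible online policy and $$\mathrm{Regret}(B,T;\mathrm{CwG})\le C\Big(1+\frac1\beta\Big)(\log T)^{\frac12+\frac1{2(\beta+1)}}\,T^{\frac12-\frac1{2(1+\beta)}}\,\mathbf 1\{\beta>0\}+C(\log T)^2+C\delta\sqrt{T\log T}+C\,\frac{\sqrt{\log(1/\varepsilon_0)}}{\varepsilon_0},$$ where the first term is read as $0$ when $\beta=0$. -/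

import Mathlib

open MeasureTheory ProbabilityTheory Set

namespace MultiSecretary

noncomputable section

/-- Quantile function `F⁻¹(q) = inf {v : F(v) ≥ q}` of a law `μ` on `[0,1]`, where `F` is the
distribution function of `μ`. (For `q ∈ (0,1]` the restriction to `v ∈ [0,1]` changes nothing;
for `q = 0` it makes the value `0`.) -/
def quantile (μ : Measure ℝ) (q : ℝ) : ℝ :=
  sInf {v : ℝ | v ∈ Icc (0 : ℝ) 1 ∧ q ≤ cdf μ v}

/-- The law `μ`, with gap quantiles `0 = q 0 < q 1 < ⋯ < q n < q (n + 1) = 1`, is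
`(β, ε₀, δ)`-clustered. -/
structure IsClusteredWith (μ : Measure ℝ) (β ε₀ δ : ℝ) {n : ℕ} (q : Fin (n + 2) → ℝ) : Prop where
  first : q 0 = 0
  last : q (Fin.last (n + 1)) = 1
  strictMono : StrictMono q
  density : ∀ i : Fin (n + 1), ∀ u ∈ Ioc (q i.castSucc) (q i.succ),
    ∀ v ∈ Ioc (q i.castSucc) (q i.succ),
      |quantile μ u - quantile μ v| ≤ |u - v| ^ (1 / (β + 1)) + δ
  size : ∀ i : Fin (n + 1), ε₀ ≤ q i.succ - q i.castSucc

/-! ### The model -/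

/-- A sample path: entry `t` holds the pair `(θ, U)` of the ability of the candidate that arrives
after `t` elapsed periods and the random number that may be used for randomization. -/
abbrev Path (T : ℕ) : Type := Fin T → ℝ × ℝ

/-- The law of the path: all abilities have law `μ`, all randomization variables are uniform on
`[0,1]`, and everything is independent. -/
def pathMeasure (μ : Measure ℝ) (T : ℕ) : Measure (Path T) :=
  Measure.pi fun _ => μ.prod (volume.restrict (Icc (0 : ℝ) 1))

/-- The offline value: the largest total ability of a set of at most `B` candidates. -/
def offlineValue {T : ℕ} (B : ℕ) (θ : Fin T → ℝ) : ℝ :=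
  ((Finset.univ : Finset (Finset (Fin T))).filter fun S => S.card ≤ B).sup'
    ⟨∅, by simp⟩ fun S => ∑ t ∈ S, θ t

/-- A policy, given by the events `π t` that candidate `t` is hired, is online (the decision on
candidate `t` is measurable with respect to the pairs `(θ, U)` up to and including `t`) and
feasible (at most `B` candidates are hired, almost surely). -/
structure IsFeasibleOnline (μ : Measure ℝ) {T : ℕ} (B : ℕ) (π : Fin T → Set (Path T)) : Prop where
  online : ∀ t, MeasurableSet[Filtration.piLE (X := fun _ : Fin T => ℝ × ℝ) t] (π t)
  feasible : ∀ᵐ ω ∂(pathMeasure μ T), {t : Fin T | ω ∈ π t}.ncard ≤ B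

/-- Expected regret of a policy: expected offline value minus expected total ability hired. -/
def regret (μ : Measure ℝ) {T : ℕ} (B : ℕ) (π : Fin T → Set (Path T)) : ℝ :=
  (∫ ω, offlineValue B (fun t => (ω t).1) ∂(pathMeasure μ T))
    - ∫ ω, ∑ t : Fin T, (π t).indicator (fun ω' => (ω' t).1) ω ∂(pathMeasure μ T)

/-! ### The policy "conservative with respect to gaps" (CwG) -/

/-- The set `{q ∈ [0,1] : F⁻¹(q) = θ}` of quantiles of the ability `θ`. It is an interval. -/
def quantileSet (μ : Measure ℝ) (θ : ℝ) : Set ℝ :=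
  {q : ℝ | q ∈ Icc (0 : ℝ) 1 ∧ quantile μ q = θ}

/-- The point at relative position `u ∈ [0,1]` of the interval `quantileSet μ θ`; for `u` uniform
on `[0,1]` this is a uniform sample from that interval. -/
def quantileSample (μ : Measure ℝ) (x : ℝ × ℝ) : ℝ :=
  sInf (quantileSet μ x.1) + x.2 * (sSup (quantileSet μ x.1) - sInf (quantileSet μ x.1))

/-- The certainty-equivalent quantile threshold after `s` elapsed periods, with remaining
budget `b`. -/
def ceThreshold (T s b : ℕ) : ℝ := 1 - (b : ℝ) / ((T : ℝ) - s)

/-- The gaps whose quantile is close to the certainty-equivalent threshold. The gap quantiles are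
the interior ones, `q 1, …, q n`, so gap `i : Fin n` has quantile `q (i + 1)`. -/
def nearGaps (T : ℕ) {n : ℕ} (q : Fin (n + 2) → ℝ) (s b : ℕ) : Set (Fin n) :=
  {i | ceThreshold T s b ∈ Metric.ball (q i.castSucc.succ)
    (Real.sqrt (2 * (Real.log ((T : ℝ) - s) / ((T : ℝ) - s))))}

/-- `p s b` is a CwG threshold after `s` elapsed periods with remaining budget `b`: the
certainty-equivalent threshold if no gap quantile is near, and otherwise a nearest gap quantile
(ties may be broken in any way). -/
def IsCwGThreshold (T : ℕ) {n : ℕ} (q : Fin (n + 2) → ℝ) (p : ℕ → ℕ → ℝ) : Prop :=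
  ∀ s b : ℕ,
    (nearGaps T q s b = ∅ ∧ p s b = ceThreshold T s b) ∨
    ∃ j ∈ nearGaps T q s b,
      (∀ i ∈ nearGaps T q s b, |ceThreshold T s b - q j.castSucc.succ|
        ≤ |ceThreshold T s b - q i.castSucc.succ|) ∧
      p s b = q j.castSucc.succ

/-- The length `T̃` of the first phase (truncated subtraction: `max {0, T - ⌊⋯⌋}`). -/
def firstPhase (T : ℕ) (ε₀ : ℝ) : ℕ := T - ⌊16 * Real.log (1 / ε₀) / ε₀ ^ 2⌋₊

/-- Remaining budget after each number of elapsed periods, when one starts with budget `B` and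
hires the candidate met after `s` elapsed periods, with remaining budget `b`, if and only if
`b > 0` and the sampled quantile of this candidate is at least `p s b`. -/
def budget (μ : Measure ℝ) {T : ℕ} (B : ℕ) (p : ℕ → ℕ → ℝ) (ω : Path T) : ℕ → ℕ
  | 0 => B
  | s + 1 =>
    if h : s < T then
      if p s (budget μ B p ω s) ≤ quantileSample μ (ω ⟨s, h⟩) ∧ 0 < budget μ B p ω s then
        budget μ B p ω s - 1
      else budget μ B p ω s
    else budget μ B p ω s

/-- The thresholds used by CwG along the path `ω`: `p` in the first phase, and afterwards the
certainty-equivalent threshold computed once, from the budget at the end of the first phase. -/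
def cwgThreshold (μ : Measure ℝ) {T : ℕ} (B : ℕ) (ε₀ : ℝ) (p : ℕ → ℕ → ℝ) (ω : Path T)
    (s b : ℕ) : ℝ :=
  if s < firstPhase T ε₀ then p s b
  else ceThreshold T (firstPhase T ε₀) (budget μ B p ω (firstPhase T ε₀))

/-- The policy CwG with budget `B` and first-phase thresholds `p`. -/
def cwg (μ : Measure ℝ) (T B : ℕ) (ε₀ : ℝ) (p : ℕ → ℕ → ℝ) (t : Fin T) : Set (Path T) :=
  {ω | cwgThreshold μ B ε₀ p ω t (budget μ B (cwgThreshold μ B ε₀ p ω) ω t)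
      ≤ quantileSample μ (ω t) ∧
    0 < budget μ B (cwgThreshold μ B ε₀ p ω) ω t}

end

end MultiSecretary

open MeasureTheory ProbabilityTheory Set

namespace MultiSecretary

noncomputable section

/-! ### The offline value -/

section Offline

variable {m : ℕ}

/-! The proof bounds the expected gap between the offline optimum and the policy's value, started
from any number `m` of remaining candidates and any budget `b ≤ m`, by recursion on `m`. If `V b` is
the offline value of the later candidates, a candidate of ability `x` who arrives with budget `b +
1` raises the optimum to at most `max (V (b+1)) (x + V b)`. A decision can therefore lose only the
distance between `x` and the marginal value `V (b+1) - V b`, and only if it lies on the wrong side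
of it. The decision on the current candidate is independent of the later ones, so the expected gap
is at most a convex combination of two later gaps plus the expected loss. Replacing the combination
by a maximum gives a bound uniform in the budget, and the law of the budget process is never needed
(`integral_valueGap_succ_le`, `integral_valueGap_le_sum`).

To estimate one loss, write abilities as `G X` with `X` uniform (`map_quantileSample`). By Hoeffding
the marginal value is bounded above and below by abilities of later candidates with quantiles below
`ce + s` and above `ce - s`, where `ce` is the certainty equivalent, off an event of probability at
most `2 exp (-2ks²)` (`measureReal_atypical_le`). The threshold is within `r` of `ce`, so outside
that event a wrong decision forces `X` into a window of length `2r`. With `r = gapRadius (k+1)` and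
`s = r/2`, the conservative threshold ensures that no gap separates `X` from the relevant later
quantile (`no_gap_above`, `no_gap_below`): either no gap is near `ce`, or the threshold sits on the
nearest gap and every other gap is at least `ε₀` away from it. Clustering then bounds the loss by
`(2r)^(1/(β+1)) + δ`, and with `r² = 2 log (k+1) / (k+1)` the expected loss is at most `lossBound`.
Summing over `k` produces the first three terms (`sum_lossBound_le`).

The separation argument needs `r < ε₀`, which fails when few candidates are left; this is why the
threshold is frozen for the last `m₀ ≤ 16 log (1/ε₀) / ε₀²` candidates. A constant threshold at the
certainty equivalent loses at most `√m₀`, by Lagrangian duality and a variance bound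
(`integral_offlineValue_sub_staticValue_le`). This is the last term. -/

lemma offlineValue_le {b : ℕ} {θ : Fin m → ℝ} {c : ℝ}
    (h : ∀ S : Finset (Fin m), S.card ≤ b → ∑ t ∈ S, θ t ≤ c) : offlineValue b θ ≤ c := by
  unfold offlineValue
  refine Finset.sup'_le _ _ fun S hS => h S ?_
  simpa using hS

lemma sum_le_offlineValue {b : ℕ} (θ : Fin m → ℝ) {S : Finset (Fin m)} (hS : S.card ≤ b) :
    ∑ t ∈ S, θ t ≤ offlineValue b θ := by
  unfold offlineValue
  exact Finset.le_sup' (fun S : Finset (Fin m) => ∑ t ∈ S, θ t) (by simpa using hS)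

lemma exists_offlineValue_eq (b : ℕ) (θ : Fin m → ℝ) :
    ∃ S : Finset (Fin m), S.card ≤ b ∧ offlineValue b θ = ∑ t ∈ S, θ t := by
  unfold offlineValue
  obtain ⟨S, hS, h⟩ := Finset.exists_mem_eq_sup'
    (s := (Finset.univ : Finset (Finset (Fin m))).filter fun S => S.card ≤ b)
    ⟨∅, by simp⟩ (fun S => ∑ t ∈ S, θ t)
  exact ⟨S, by simpa using hS, h⟩

lemma offlineValue_nonneg (b : ℕ) (θ : Fin m → ℝ) : 0 ≤ offlineValue b θ := by
  simpa using sum_le_offlineValue (b := b) θ (S := ∅) (by simp)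

lemma offlineValue_zero (θ : Fin m → ℝ) : offlineValue 0 θ = 0 := by
  refine le_antisymm (offlineValue_le fun S hS => ?_) (offlineValue_nonneg 0 θ)
  simp [Finset.card_eq_zero.1 (Nat.le_zero.1 hS)]

lemma offlineValue_mono {b c : ℕ} (h : b ≤ c) (θ : Fin m → ℝ) :
    offlineValue b θ ≤ offlineValue c θ :=
  offlineValue_le fun _ hS => sum_le_offlineValue θ (hS.trans h)

lemma offlineValue_succ_card (θ : Fin m → ℝ) :
    offlineValue (m + 1) θ ≤ offlineValue m θ :=
  offlineValue_le fun S _ => sum_le_offlineValue θ (by simpa using S.card_le_univ)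

lemma abs_offlineValue_le (b : ℕ) (θ : Fin m → ℝ) : |offlineValue b θ| ≤ ∑ t, |θ t| := by
  rw [abs_of_nonneg (offlineValue_nonneg b θ)]
  refine offlineValue_le fun S _ => ?_
  calc ∑ t ∈ S, θ t ≤ ∑ t ∈ S, |θ t| := Finset.sum_le_sum fun t _ => le_abs_self _
    _ ≤ ∑ t, |θ t| := Finset.sum_le_univ_sum_of_nonneg fun t => abs_nonneg _

/-- Either the first candidate is not hired, or one unit of budget is spent on it. -/
lemma offlineValue_cons_le (b : ℕ) (x : ℝ) (θ : Fin m → ℝ) :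
    offlineValue (b + 1) (Fin.cons x θ : Fin (m + 1) → ℝ)
      ≤ max (offlineValue (b + 1) θ) (x + offlineValue b θ) := by
  refine offlineValue_le fun S hS => ?_
  set S' : Finset (Fin m) := S.preimage Fin.succ (Fin.succ_injective _).injOn with hS'
  have himg : S'.image Fin.succ = S.erase 0 := by
    ext i
    refine Fin.cases ?_ (fun j => ?_) i
    · simp [Fin.succ_ne_zero]
    · simp [hS', Fin.succ_ne_zero]
  have hcard : S'.card = (S.erase 0).card := by
    rw [← himg, Finset.card_image_of_injective _ (Fin.succ_injective _)]
  have hsum : ∑ t ∈ S.erase 0, (Fin.cons x θ : Fin (m + 1) → ℝ) t = ∑ t ∈ S', θ t := by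
    rw [← himg, Finset.sum_image (Fin.succ_injective _).injOn]
    simp
  by_cases h0 : (0 : Fin (m + 1)) ∈ S
  · refine le_max_of_le_right ?_
    rw [← Finset.add_sum_erase S _ h0, hsum]
    have : S'.card ≤ b := by rw [hcard, Finset.card_erase_of_mem h0]; omega
    simpa using sum_le_offlineValue θ this
  · refine le_max_of_le_left ?_
    rw [← Finset.erase_eq_of_notMem h0, hsum]
    refine sum_le_offlineValue θ ?_
    rw [hcard, Finset.erase_eq_of_notMem h0]; exact hS

/-- Among more than `m - b` candidates one bounds the marginal value of the `b`-th unit of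
budget from above. -/
lemma exists_offlineValue_succ_le {b : ℕ} {θ : Fin m → ℝ} (hθ : ∀ i, 0 ≤ θ i)
    {A : Finset (Fin m)} (hA : m < A.card + (b + 1)) (hne : A.Nonempty) :
    ∃ i ∈ A, offlineValue (b + 1) θ ≤ offlineValue b θ + θ i := by
  obtain ⟨S, hS, hval⟩ := exists_offlineValue_eq (b + 1) θ
  rcases Nat.lt_or_ge b S.card with h | h
  -- An optimal set that uses all `b + 1` units is too large to be disjoint from `A`; removing a
  -- common element costs at most its ability.
  · have hint : (S ∩ A).Nonempty := by
      have h1 := Finset.card_union_add_card_inter S A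
      have h2 : (S ∪ A).card ≤ m := by simpa using (S ∪ A).card_le_univ
      rw [← Finset.card_pos]; omega
    obtain ⟨i, hi⟩ := hint
    rw [Finset.mem_inter] at hi
    refine ⟨i, hi.2, ?_⟩
    have : (S.erase i).card ≤ b := by rw [Finset.card_erase_of_mem hi.1]; omega
    rw [hval, ← Finset.sum_erase_add S _ hi.1]
    linarith [sum_le_offlineValue θ this]
  · obtain ⟨i, hi⟩ := hne
    exact ⟨i, hi, by rw [hval]; linarith [sum_le_offlineValue θ h, hθ i]⟩

/-- Among more than `b` candidates one bounds the marginal value of the `(b + 1)`-st unit of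
budget from below. -/
lemma exists_le_offlineValue_succ {b : ℕ} (θ : Fin m → ℝ)
    {A : Finset (Fin m)} (hA : b < A.card) :
    ∃ i ∈ A, offlineValue b θ + θ i ≤ offlineValue (b + 1) θ := by
  obtain ⟨S, hS, hval⟩ := exists_offlineValue_eq b θ
  obtain ⟨i, hi, hiS⟩ := Finset.exists_mem_notMem_of_card_lt_card (hS.trans_lt hA)
  refine ⟨i, hi, ?_⟩
  have := sum_le_offlineValue (b := b + 1) θ (S := insert i S)
    (by rw [Finset.card_insert_of_notMem hiS]; omega)
  rw [Finset.sum_insert hiS] at this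
  linarith

lemma offlineValue_succ_le_add_one {b : ℕ} {θ : Fin m → ℝ} (h0 : ∀ i, 0 ≤ θ i)
    (h1 : ∀ i, θ i ≤ 1) : offlineValue (b + 1) θ ≤ offlineValue b θ + 1 := by
  rcases Nat.eq_zero_or_pos m with rfl | hm
  · have : offlineValue (b + 1) θ ≤ 0 := offlineValue_le fun S _ => by
      simp [Finset.eq_empty_of_isEmpty S]
    linarith [offlineValue_nonneg b θ]
  · obtain ⟨i, -, hi⟩ := exists_offlineValue_succ_le (b := b) h0 (A := Finset.univ)
      (by simp) ⟨⟨0, hm⟩, Finset.mem_univ _⟩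
    linarith [h1 i]

/-- Lagrangian bound with the price `g` per unit of budget. -/
lemma offlineValue_le_lagrangian (b : ℕ) (θ : Fin m → ℝ) {g : ℝ} (hg : 0 ≤ g) :
    offlineValue b θ ≤ b * g + ∑ t, max (θ t - g) 0 := by
  refine offlineValue_le fun S hS => ?_
  have h1 : ∑ t ∈ S, θ t ≤ S.card * g + ∑ t ∈ S, max (θ t - g) 0 := by
    rw [← nsmul_eq_mul, ← Finset.sum_const, ← Finset.sum_add_distrib]
    exact Finset.sum_le_sum fun t _ => by linarith [le_max_left (θ t - g) 0]
  have h2 : ∑ t ∈ S, max (θ t - g) 0 ≤ ∑ t, max (θ t - g) 0 :=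
    Finset.sum_le_univ_sum_of_nonneg fun t => le_max_right _ _
  have h3 : (S.card : ℝ) * g ≤ b * g := by gcongr
  linarith

lemma measurable_offlineValue (b : ℕ) :
    Measurable (fun θ : Fin m → ℝ => offlineValue b θ) := by
  refine measurable_of_Iic fun c => ?_
  have h : (fun θ : Fin m → ℝ => offlineValue b θ) ⁻¹' Iic c
      = ⋂ S : {S : Finset (Fin m) // S.card ≤ b}, {θ | ∑ t ∈ S.1, θ t ≤ c} := by
    ext θ
    simp only [mem_preimage, mem_Iic, mem_iInter, mem_ofPred_eq, Subtype.forall]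
    exact ⟨fun h S hS => (sum_le_offlineValue θ hS).trans h, offlineValue_le⟩
  rw [h]
  exact MeasurableSet.iInter fun S => measurableSet_le
    (Finset.measurable_sum _ fun t _ => measurable_pi_apply t) measurable_const

end Offline

/-! ### Quantiles and the sampled quantile -/

section Quantile

variable {μ : Measure ℝ}

lemma quantile_bddBelow (q : ℝ) : BddBelow {v : ℝ | v ∈ Icc (0 : ℝ) 1 ∧ q ≤ cdf μ v} :=
  ⟨0, fun _ hv => hv.1.1⟩

lemma quantile_nonneg (q : ℝ) : 0 ≤ quantile μ q :=
  Real.sInf_nonneg fun _ hv => hv.1.1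

lemma quantile_le {q v : ℝ} (hv : v ∈ Icc (0 : ℝ) 1) (h : q ≤ cdf μ v) : quantile μ q ≤ v :=
  csInf_le (quantile_bddBelow q) ⟨hv, h⟩

variable [IsProbabilityMeasure μ]

lemma cdf_one (hμ : μ (Icc (0 : ℝ) 1)ᶜ = 0) : cdf μ 1 = 1 := by
  rw [cdf_eq_real, measureReal_def, (prob_compl_eq_zero_iff measurableSet_Iic).1,
    ENNReal.toReal_one]
  refine measure_mono_null (fun x hx => ?_) hμ
  simp only [mem_compl_iff, mem_Iic, mem_Icc, not_le, not_and] at hx ⊢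
  exact fun _ => hx

lemma quantile_mem_Icc (hμ : μ (Icc (0 : ℝ) 1)ᶜ = 0) {q : ℝ} (hq : q ≤ 1) :
    quantile μ q ∈ Icc (0 : ℝ) 1 :=
  ⟨quantile_nonneg q, quantile_le ⟨zero_le_one, le_rfl⟩ (by rwa [cdf_one hμ])⟩

/-- Points at which the distribution function is at least `q` accumulate from the right at their
infimum, so right continuity applies. -/
lemma le_cdf_quantile (hμ : μ (Icc (0 : ℝ) 1)ᶜ = 0) {q : ℝ} (hq : q ≤ 1) :
    q ≤ cdf μ (quantile μ q) := by
  have hne : {v : ℝ | v ∈ Icc (0 : ℝ) 1 ∧ q ≤ cdf μ v}.Nonempty :=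
    ⟨1, ⟨zero_le_one, le_rfl⟩, by rwa [cdf_one hμ]⟩
  have hcont := (cdf μ).right_continuous (quantile μ q)
  refine ge_of_tendsto_of_frequently hcont ?_
  rw [Filter.frequently_iff]
  intro U hU
  obtain ⟨u, hu, hsub⟩ := mem_nhdsGE_iff_exists_Ico_subset.1 hU
  obtain ⟨v, hv, hvu⟩ := exists_lt_of_csInf_lt hne hu
  exact ⟨v, hsub ⟨quantile_le hv.1 hv.2, hvu⟩, hv.2⟩

lemma quantile_mono (hμ : μ (Icc (0 : ℝ) 1)ᶜ = 0) {q r : ℝ} (hr : r ≤ 1) (h : q ≤ r) :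
    quantile μ q ≤ quantile μ r :=
  quantile_le (quantile_mem_Icc hμ hr) (h.trans (le_cdf_quantile hμ hr))

/-- Abilities that are not the quantile of anything: the distribution function is constant to
the left of them. -/
def skipped (μ : Measure ℝ) : Set ℝ :=
  ⋃ v : ℚ, {θ : ℝ | (v : ℝ) < θ ∧ cdf μ θ ≤ cdf μ v}

lemma measurableSet_skipped : MeasurableSet (skipped μ) := by
  refine MeasurableSet.iUnion fun v => ?_
  exact (measurableSet_lt measurable_const measurable_id).inter
    (measurableSet_le (monotone_cdf μ).measurable measurable_const)

lemma measure_Ioc_eq_zero {v w : ℝ} (h : cdf μ w ≤ cdf μ v) : μ (Ioc v w) = 0 := by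
  rw [← measure_cdf μ, StieltjesFunction.measure_Ioc]
  simpa using h

/-- For each rational `v` the flat stretch to the right of `v` is covered by countably many null
intervals with rational right end, plus its greatest element if there is one, which lies in a null
interval as well. -/
lemma measure_skipped : μ (skipped μ) = 0 := by
  refine measure_iUnion_null fun v => ?_
  set A := {θ : ℝ | (v : ℝ) < θ ∧ cdf μ θ ≤ cdf μ v} with hA
  set S := {w ∈ A | ∀ r ∈ A, r ≤ w}
  have hsub : A ⊆ (⋃ r : {r : ℚ // (r : ℝ) ∈ A}, Ioc (v : ℝ) r) ∪ S := by
    intro θ hθ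
    by_cases hmax : ∀ r ∈ A, r ≤ θ
    · exact Or.inr ⟨hθ, hmax⟩
    · left
      push Not at hmax
      obtain ⟨w, hw, hlt⟩ := hmax
      obtain ⟨r, hr1, hr2⟩ := exists_rat_btwn hlt
      have hr : (r : ℝ) ∈ A := ⟨hθ.1.trans hr1, (monotone_cdf μ hr2.le).trans hw.2⟩
      exact mem_iUnion.2 ⟨⟨r, hr⟩, hθ.1, hr1.le⟩
  refine measure_mono_null hsub (measure_union_null (measure_iUnion_null fun r =>
    measure_Ioc_eq_zero r.2.2) ?_)
  by_cases hS : S.Nonempty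
  · obtain ⟨w, hw⟩ := hS
    refine measure_mono_null (t := Ioc (v : ℝ) w) ?_ (measure_Ioc_eq_zero hw.1.2)
    exact fun x hx => ⟨hx.1.1, hw.2 x hx.1⟩
  · rw [not_nonempty_iff_eq_empty.1 hS]; exact measure_empty

/-- The left limit of the distribution function. -/
def cdfLeft (μ : Measure ℝ) (θ : ℝ) : ℝ := μ.real (Iio θ)

lemma cdfLeft_mono : Monotone (cdfLeft μ) := fun _ _ h =>
  measureReal_mono (Iio_subset_Iio h)

lemma cdfLeft_nonneg (θ : ℝ) : 0 ≤ cdfLeft μ θ := measureReal_nonneg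

lemma cdfLeft_le_cdf (θ : ℝ) : cdfLeft μ θ ≤ cdf μ θ := by
  rw [cdf_eq_real]; exact measureReal_mono Iio_subset_Iic_self

lemma cdf_le_cdfLeft {v θ : ℝ} (h : v < θ) : cdf μ v ≤ cdfLeft μ θ := by
  rw [cdf_eq_real]; exact measureReal_mono fun x hx => lt_of_le_of_lt hx h

lemma measureReal_singleton_eq (θ : ℝ) : μ.real {θ} = cdf μ θ - cdfLeft μ θ := by
  have h := measureReal_union (μ := μ) (s₁ := Iio θ) (s₂ := {θ}) (by simp)
    (measurableSet_singleton θ)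
  rw [Iio_union_right] at h
  rw [cdf_eq_real, cdfLeft]; linarith

lemma exists_lt_cdf_of_lt_cdfLeft {θ x : ℝ} (hx : x < cdfLeft μ θ) :
    ∃ v < θ, x < cdf μ v := by
  have ht : Filter.Tendsto (fun n : ℕ => μ.real (Iic (θ - 1 / ((n : ℝ) + 1)))) Filter.atTop
      (nhds (μ.real (⋃ n : ℕ, Iic (θ - 1 / ((n : ℝ) + 1))))) := by
    simp only [measureReal_def]
    refine (ENNReal.tendsto_toReal (measure_ne_top _ _)).comp
      (tendsto_measure_iUnion_atTop fun i j hij => Iic_subset_Iic.2 ?_)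
    have : 1 / ((j : ℝ) + 1) ≤ 1 / ((i : ℝ) + 1) := by
      apply one_div_le_one_div_of_le (by positivity)
      exact_mod_cast Nat.succ_le_succ hij
    linarith
  have hU : (⋃ n : ℕ, Iic (θ - 1 / ((n : ℝ) + 1))) = Iio θ := by
    ext y
    simp only [mem_iUnion, mem_Iic, mem_Iio]
    constructor
    · rintro ⟨n, hn⟩
      have : 0 < 1 / ((n : ℝ) + 1) := by positivity
      linarith
    · intro hy
      obtain ⟨n, hn⟩ := exists_nat_one_div_lt (sub_pos.2 hy)
      exact ⟨n, by linarith⟩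
  rw [hU] at ht
  obtain ⟨n, hn⟩ := (ht.eventually (lt_mem_nhds hx)).exists
  refine ⟨θ - 1 / ((n : ℝ) + 1), ?_, by rwa [cdf_eq_real]⟩
  have : 0 < 1 / ((n : ℝ) + 1) := by positivity
  linarith

lemma cdf_lt_of_notMem_skipped {v θ : ℝ} (hθ : θ ∉ skipped μ) (h : v < θ) :
    cdf μ v < cdf μ θ := by
  obtain ⟨r, hr1, hr2⟩ := exists_rat_btwn h
  by_contra! hc
  exact hθ (mem_iUnion.2 ⟨r, hr2, hc.trans (monotone_cdf μ hr1.le)⟩)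

/-- A two-sided inclusion, because the left endpoint `cdfLeft μ θ` may or may not belong to the set.
Infimum and supremum do not depend on this. -/
lemma quantileSet_of_pos (hμ : μ (Icc (0 : ℝ) 1)ᶜ = 0) {θ : ℝ} (h0 : 0 < θ) (h1 : θ ≤ 1)
    (hs : θ ∉ skipped μ) :
    cdf μ θ ∈ quantileSet μ θ ∧ Ioc (cdfLeft μ θ) (cdf μ θ) ⊆ quantileSet μ θ ∧
      quantileSet μ θ ⊆ Icc (cdfLeft μ θ) (cdf μ θ) := by
  have hθ : θ ∈ Icc (0 : ℝ) 1 := ⟨h0.le, h1⟩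
  have key : ∀ q, q ≤ cdf μ θ → (∀ v ∈ Ico 0 θ, cdf μ v < q) → 0 ≤ q → q ∈ quantileSet μ θ := by
    intro q hq hv hq0
    have hq1 := hq.trans (cdf_le_one μ θ)
    refine ⟨⟨hq0, hq1⟩, le_antisymm (quantile_le hθ hq) ?_⟩
    by_contra! hlt
    exact absurd (le_cdf_quantile hμ hq1) (not_le.2 (hv _ ⟨quantile_nonneg q, hlt⟩))
  refine ⟨key _ le_rfl (fun v hv => cdf_lt_of_notMem_skipped hs hv.2) (cdf_nonneg μ θ),
    fun q hq => key q hq.2 (fun v hv => (cdf_le_cdfLeft hv.2).trans_lt hq.1)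
      ((cdfLeft_nonneg θ).trans hq.1.le), ?_⟩
  rintro q ⟨hq, hqθ⟩
  refine ⟨?_, by rw [← hqθ]; exact le_cdf_quantile hμ hq.2⟩
  by_contra! hlt
  obtain ⟨v, hv, hlt'⟩ := exists_lt_cdf_of_lt_cdfLeft hlt
  rcases le_or_gt 0 v with hv0 | hv0
  · have := quantile_le (μ := μ) ⟨hv0, hv.le.trans h1⟩ hlt'.le
    linarith
  · have := quantile_le (μ := μ) ⟨le_rfl, zero_le_one⟩ (hlt'.le.trans (monotone_cdf μ hv0.le))
    linarith

lemma cdfLeft_zero (hμ : μ (Icc (0 : ℝ) 1)ᶜ = 0) : cdfLeft μ 0 = 0 := by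
  rw [cdfLeft, measureReal_def, measure_mono_null _ hμ, ENNReal.toReal_zero]
  exact fun x hx h => absurd h.1 (not_le.2 hx)

/-- Zero is treated apart: it is always the quantile of `0`, because the infimum is restricted to
`[0,1]`, even when it lies in `skipped μ`. -/
lemma quantileSet_zero (hμ : μ (Icc (0 : ℝ) 1)ᶜ = 0) : quantileSet μ 0 = Icc 0 (cdf μ 0) := by
  ext q
  refine ⟨fun hq => ⟨hq.1.1, ?_⟩, fun h => ⟨⟨h.1, h.2.trans (cdf_le_one μ 0)⟩,
    le_antisymm (quantile_le ⟨le_rfl, zero_le_one⟩ h.2) (quantile_nonneg q)⟩⟩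
  have := le_cdf_quantile hμ hq.1.2
  rwa [hq.2] at this

lemma sInf_sSup_quantileSet_zero (hμ : μ (Icc (0 : ℝ) 1)ᶜ = 0) :
    sInf (quantileSet μ 0) = cdfLeft μ 0 ∧ sSup (quantileSet μ 0) = cdf μ 0 := by
  rw [quantileSet_zero hμ, cdfLeft_zero hμ]
  exact ⟨csInf_Icc (cdf_nonneg μ 0), csSup_Icc (cdf_nonneg μ 0)⟩

lemma sInf_sSup_quantileSet (hμ : μ (Icc (0 : ℝ) 1)ᶜ = 0) {θ : ℝ} (hθ : θ ∈ Icc (0 : ℝ) 1)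
    (hs : θ ∉ skipped μ) :
    sInf (quantileSet μ θ) = cdfLeft μ θ ∧ sSup (quantileSet μ θ) = cdf μ θ := by
  obtain ⟨h0, h1⟩ := hθ
  rcases h0.eq_or_lt with rfl | h0
  · exact sInf_sSup_quantileSet_zero hμ
  · obtain ⟨hmem, hsub, hsup⟩ := quantileSet_of_pos hμ h0 h1 hs
    refine ⟨csInf_eq_of_forall_ge_of_forall_gt_exists_lt ⟨_, hmem⟩ (fun a ha => (hsup ha).1)
      fun w hw => ?_, IsGreatest.csSup_eq ⟨hmem, fun a ha => (hsup ha).2⟩⟩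
    rcases lt_or_ge (cdf μ θ) w with h | h
    · exact ⟨_, hmem, h⟩
    · exact ⟨(cdfLeft μ θ + w) / 2, hsub ⟨by linarith, by linarith⟩, by linarith⟩

lemma quantileSet_eq_empty (hμ : μ (Icc (0 : ℝ) 1)ᶜ = 0) {θ : ℝ}
    (h : ¬ (θ ∈ Icc (0 : ℝ) 1 ∧ (θ = 0 ∨ θ ∉ skipped μ))) : quantileSet μ θ = ∅ := by
  rw [eq_empty_iff_forall_notMem]
  rintro q ⟨hq, rfl⟩
  refine h ⟨quantile_mem_Icc hμ hq.2, ?_⟩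
  rcases (quantile_nonneg (μ := μ) q).eq_or_lt with h0 | h0
  · exact Or.inl h0.symm
  · refine Or.inr fun hsk => ?_
    obtain ⟨v, hv, hle⟩ := mem_iUnion.1 hsk
    have hqv : q ≤ cdf μ v := (le_cdf_quantile hμ hq.2).trans hle
    rcases le_or_gt (0 : ℝ) v with h | h
    · have := quantile_le ⟨h, hv.le.trans (quantile_mem_Icc hμ hq.2).2⟩ hqv
      linarith
    · have := quantile_le (μ := μ) ⟨le_rfl, zero_le_one⟩ (hqv.trans (monotone_cdf μ h.le))
      linarith

/-- The abilities that are quantiles. -/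
def attained (μ : Measure ℝ) : Set ℝ := Icc 0 1 ∩ ({0} ∪ (skipped μ)ᶜ)

lemma measurableSet_attained : MeasurableSet (attained μ) :=
  measurableSet_Icc.inter ((measurableSet_singleton 0).union measurableSet_skipped.compl)

-- The formula holds everywhere and not just almost everywhere, since the policy must be measurable
-- for the filtration itself and not for a completion.
open Classical in
lemma quantileSample_eq (hμ : μ (Icc (0 : ℝ) 1)ᶜ = 0) (x : ℝ × ℝ) :
    quantileSample μ x = if x.1 ∈ attained μ then
      cdfLeft μ x.1 + x.2 * (cdf μ x.1 - cdfLeft μ x.1) else 0 := by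
  unfold quantileSample
  split_ifs with h
  · have : sInf (quantileSet μ x.1) = cdfLeft μ x.1 ∧ sSup (quantileSet μ x.1) = cdf μ x.1 := by
      rcases h.2 with h0 | h0
      · rw [mem_singleton_iff.1 h0]; exact sInf_sSup_quantileSet_zero hμ
      · exact sInf_sSup_quantileSet hμ h.1 h0
    rw [this.1, this.2]
  · rw [quantileSet_eq_empty hμ h]; simp

lemma measurable_quantileSample (hμ : μ (Icc (0 : ℝ) 1)ᶜ = 0) :
    Measurable (quantileSample μ) := by
  classical
  rw [funext (quantileSample_eq hμ)]
  have hL : Measurable (cdfLeft μ) := cdfLeft_mono.measurable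
  have hF : Measurable (cdf μ) := (monotone_cdf μ).measurable
  refine Measurable.ite (measurable_fst measurableSet_attained) ?_ measurable_const
  exact (hL.comp measurable_fst).add (measurable_snd.mul
    ((hF.comp measurable_fst).sub (hL.comp measurable_fst)))

/-- The law of one candidate: ability and randomization variable. -/
abbrev candidate (μ : Measure ℝ) : Measure (ℝ × ℝ) := μ.prod (volume.restrict (Icc (0 : ℝ) 1))

instance : IsProbabilityMeasure (volume.restrict (Icc (0 : ℝ) 1)) := ⟨by simp⟩

lemma ae_candidate (hμ : μ (Icc (0 : ℝ) 1)ᶜ = 0) :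
    ∀ᵐ x ∂(candidate μ), x.1 ∈ Icc (0 : ℝ) 1 ∧ x.1 ∉ skipped μ ∧ x.2 ∈ Ioc (0 : ℝ) 1 := by
  have h1 : ∀ᵐ θ ∂μ, θ ∈ Icc (0 : ℝ) 1 := hμ
  have h2 : ∀ᵐ θ ∂μ, θ ∉ skipped μ := measure_eq_zero_iff_ae_notMem.1 measure_skipped
  have h3 : ∀ᵐ u ∂(volume.restrict (Icc (0 : ℝ) 1)), u ∈ Ioc (0 : ℝ) 1 := by
    rw [← restrict_Ioc_eq_restrict_Icc]
    exact ae_restrict_mem measurableSet_Ioc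
  filter_upwards [Measure.quasiMeasurePreserving_fst.ae h1, Measure.quasiMeasurePreserving_fst.ae h2,
    Measure.quasiMeasurePreserving_snd.ae h3] with x a b c using ⟨a, b, c⟩

lemma quantileSample_eq_of_mem (hμ : μ (Icc (0 : ℝ) 1)ᶜ = 0) {x : ℝ × ℝ}
    (h1 : x.1 ∈ Icc (0 : ℝ) 1) (h2 : x.1 ∉ skipped μ) :
    quantileSample μ x = cdfLeft μ x.1 + x.2 * (cdf μ x.1 - cdfLeft μ x.1) := by
  classical
  rw [quantileSample_eq hμ, if_pos ⟨h1, Or.inr h2⟩]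

/-- Sampling a quantile inverts the quantile function. -/
lemma quantile_quantileSample (hμ : μ (Icc (0 : ℝ) 1)ᶜ = 0) {x : ℝ × ℝ}
    (h1 : x.1 ∈ Icc (0 : ℝ) 1) (h2 : x.1 ∉ skipped μ) (h3 : x.2 ∈ Ioc (0 : ℝ) 1) :
    quantile μ (quantileSample μ x) = x.1 := by
  rw [quantileSample_eq_of_mem hμ h1 h2]
  have hle := cdfLeft_le_cdf (μ := μ) x.1
  rcases h1.1.eq_or_lt with h0 | h0
  · have : cdfLeft μ x.1 + x.2 * (cdf μ x.1 - cdfLeft μ x.1) ∈ quantileSet μ 0 := by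
      rw [quantileSet_zero hμ, ← h0, cdfLeft_zero hμ]
      have := cdf_nonneg μ 0
      constructor <;> nlinarith [h3.1, h3.2]
    rw [← h0]; rw [← h0] at this; exact this.2
  · obtain ⟨hmem, hsub, -⟩ := quantileSet_of_pos hμ h0 h1.2 h2
    rcases hle.eq_or_lt with he | hlt
    · rw [he, sub_self, mul_zero, add_zero]; exact hmem.2
    · exact (hsub ⟨by nlinarith [h3.1], by nlinarith [h3.2]⟩).2

lemma quantileSample_mem_Icc (hμ : μ (Icc (0 : ℝ) 1)ᶜ = 0) {x : ℝ × ℝ}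
    (h1 : x.1 ∈ Icc (0 : ℝ) 1) (h2 : x.1 ∉ skipped μ) (h3 : x.2 ∈ Ioc (0 : ℝ) 1) :
    quantileSample μ x ∈ Icc (cdfLeft μ x.1) (cdf μ x.1) := by
  rw [quantileSample_eq_of_mem hμ h1 h2]
  have hle := cdfLeft_le_cdf (μ := μ) x.1
  constructor <;> nlinarith [h3.1, h3.2]

lemma volume_real_mul_le {d c : ℝ} (hd : 0 < d) (h0 : 0 ≤ c) (h1 : c ≤ d) :
    (volume.restrict (Icc (0 : ℝ) 1)).real {u | u * d ≤ c} = c / d := by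
  have hset : {u : ℝ | u * d ≤ c} = Iic (c / d) := by
    ext u; simp [le_div_iff₀ hd]
  have h1' : c / d ≤ 1 := (div_le_one hd).2 h1
  have hI : Iic (c / d) ∩ Icc (0 : ℝ) 1 = Icc 0 (c / d) := by
    ext u; simp only [mem_inter_iff, mem_Iic, mem_Icc]
    exact ⟨fun h => ⟨h.2.1, h.1⟩, fun h => ⟨h.2, h.1, h.2.trans h1'⟩⟩
  rw [measureReal_restrict_apply (hset ▸ measurableSet_Iic), hset, hI,
    Real.volume_real_Icc_of_le (by positivity), sub_zero]

lemma quantile_mem_Icc_cdf (hμ : μ (Icc (0 : ℝ) 1)ᶜ = 0) {q : ℝ} (hq : q ∈ Ioc (0 : ℝ) 1) :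
    q ∈ Icc (cdfLeft μ (quantile μ q)) (cdf μ (quantile μ q)) := by
  refine ⟨?_, le_cdf_quantile hμ hq.2⟩
  by_contra! hlt
  obtain ⟨v, hv, hlt'⟩ := exists_lt_cdf_of_lt_cdfLeft hlt
  rcases le_or_gt 0 v with hv0 | hv0
  · have := quantile_le (μ := μ) ⟨hv0, hv.le.trans (quantile_mem_Icc hμ hq.2).2⟩ hlt'.le
    linarith
  · have : cdf μ v = 0 := by
      rw [cdf_eq_real, measureReal_def, measure_mono_null _ hμ, ENNReal.toReal_zero]
      exact fun x hx h => absurd h.1 (not_le.2 (lt_of_le_of_lt hx hv0))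
    linarith [hq.1]

/-- With `θ₀ = quantile μ q`, a sample below `q` comes from an ability below `θ₀`, or from `θ₀`
itself with `U` small; abilities above `θ₀` have samples at least `cdf μ θ₀ ≥ q`. The two masses add
up to `q`. -/
lemma measureReal_quantileSample_lt_le (hμ : μ (Icc (0 : ℝ) 1)ᶜ = 0) {q : ℝ}
    (hq : q ∈ Ioc (0 : ℝ) 1) : (candidate μ).real {x | quantileSample μ x < q} ≤ q := by
  set θ₀ := quantile μ q
  obtain ⟨hL, hR⟩ := quantile_mem_Icc_cdf hμ hq
  have hsub : {x | quantileSample μ x < q} ≤ᵐ[candidate μ]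
      ((Iio θ₀ ×ˢ univ) ∪ ({θ₀} ×ˢ {u | u * (cdf μ θ₀ - cdfLeft μ θ₀) ≤ q - cdfLeft μ θ₀}) :
        Set (ℝ × ℝ)) := by
    filter_upwards [ae_candidate hμ] with x hx hlt
    change quantileSample μ x < q at hlt
    rcases lt_trichotomy x.1 θ₀ with h | h | h
    · exact Or.inl ⟨h, trivial⟩
    · right
      refine ⟨h, ?_⟩
      rw [quantileSample_eq_of_mem hμ hx.1 hx.2.1, h] at hlt
      simp only [mem_ofPred_eq]; linarith
    · exfalso
      have h1 := (quantileSample_mem_Icc hμ hx.1 hx.2.1 hx.2.2).1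
      have h2 := cdf_le_cdfLeft (μ := μ) h
      linarith
  have h1 : (candidate μ).real {x | quantileSample μ x < q} ≤ _ :=
    ENNReal.toReal_mono (measure_ne_top _ _) (measure_mono_ae hsub)
  refine h1.trans ((measureReal_union_le _ _).trans ?_)
  rw [measureReal_prod_prod, measureReal_prod_prod, measureReal_singleton_eq]
  rcases (cdfLeft_le_cdf (μ := μ) θ₀).eq_or_lt with he | hlt
  · rw [← he]; simp; exact hL
  · rw [volume_real_mul_le (sub_pos.2 hlt) (by linarith) (by linarith),
      mul_div_cancel₀ _ (sub_pos.2 hlt).ne']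
    simp [cdfLeft]

lemma le_measureReal_quantileSample_le (hμ : μ (Icc (0 : ℝ) 1)ᶜ = 0) {q : ℝ}
    (hq : q ∈ Ioc (0 : ℝ) 1) : q ≤ (candidate μ).real {x | quantileSample μ x ≤ q} := by
  set θ₀ := quantile μ q
  obtain ⟨hL, hR⟩ := quantile_mem_Icc_cdf hμ hq
  have hsub : ((Iio θ₀ ×ˢ univ) ∪
      ({θ₀} ×ˢ {u | u * (cdf μ θ₀ - cdfLeft μ θ₀) ≤ q - cdfLeft μ θ₀}) :
        Set (ℝ × ℝ)) ≤ᵐ[candidate μ] {x | quantileSample μ x ≤ q} := by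
    filter_upwards [ae_candidate hμ] with x hx hmem
    change quantileSample μ x ≤ q
    rcases hmem with h | h
    · have h1 := (quantileSample_mem_Icc hμ hx.1 hx.2.1 hx.2.2).2
      exact h1.trans ((cdf_le_cdfLeft h.1).trans hL)
    · have h1 : x.1 = θ₀ := h.1
      have h2 : x.2 * (cdf μ θ₀ - cdfLeft μ θ₀) ≤ q - cdfLeft μ θ₀ := h.2
      rw [quantileSample_eq_of_mem hμ hx.1 hx.2.1, h1]
      linarith
  have h1 : _ ≤ (candidate μ).real {x | quantileSample μ x ≤ q} :=
    ENNReal.toReal_mono (measure_ne_top _ _) (measure_mono_ae hsub)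
  refine le_trans ?_ h1
  rw [← measureReal_def, measureReal_union, measureReal_prod_prod, measureReal_prod_prod,
    measureReal_singleton_eq]
  · rcases (cdfLeft_le_cdf (μ := μ) θ₀).eq_or_lt with he | hlt
    · rw [← he]; simp; change _ ≤ cdfLeft μ θ₀; linarith
    · rw [volume_real_mul_le (sub_pos.2 hlt) (by linarith) (by linarith),
        mul_div_cancel₀ _ (sub_pos.2 hlt).ne']
      simp [cdfLeft]
  · rw [disjoint_left]
    rintro x hx hx'
    exact (hx.1 : x.1 < θ₀).ne hx'.1
  · exact (measurableSet_singleton _).prod (measurableSet_le (by fun_prop) measurable_const)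

/-- The sampled quantile is uniform on `[0,1]`. -/
lemma map_quantileSample (hμ : μ (Icc (0 : ℝ) 1)ᶜ = 0) :
    (candidate μ).map (quantileSample μ) = volume.restrict (Icc (0 : ℝ) 1) := by
  have hm := measurable_quantileSample hμ
  have : IsProbabilityMeasure ((candidate μ).map (quantileSample μ)) :=
    Measure.isProbabilityMeasure_map hm.aemeasurable
  have hmem : ∀ᵐ x ∂(candidate μ), quantileSample μ x ∈ Icc (0 : ℝ) 1 := by
    filter_upwards [ae_candidate hμ] with x hx
    have := quantileSample_mem_Icc hμ hx.1 hx.2.1 hx.2.2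
    exact ⟨(cdfLeft_nonneg _).trans this.1, this.2.trans (cdf_le_one μ _)⟩
  have hIic : ∀ q ∈ Ico (0 : ℝ) 1, (candidate μ).real {x | quantileSample μ x ≤ q} = q := by
    intro q hq
    -- The upper estimate is available only for strict inequalities, so it is applied at levels `r >
    -- q`, capped at `1`.
    refine le_antisymm (le_of_forall_gt_imp_ge_of_dense fun r hr => ?_) ?_
    · refine le_trans ?_ ((measureReal_quantileSample_lt_le hμ (q := min r 1)
        ⟨lt_min (hq.1.trans_lt hr) one_pos, min_le_right _ _⟩).trans (min_le_left _ _))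
      exact measureReal_mono fun x hx => lt_of_le_of_lt hx (lt_min hr hq.2)
    · rcases hq.1.eq_or_lt with rfl | h
      · exact measureReal_nonneg
      · exact le_measureReal_quantileSample_le hμ ⟨h, hq.2.le⟩
  refine Measure.ext_of_Iic _ _ fun q => ?_
  rw [← measureReal_eq_measureReal_iff, map_measureReal_apply hm measurableSet_Iic,
    measureReal_restrict_apply measurableSet_Iic]
  change (candidate μ).real {x | quantileSample μ x ≤ q} = _
  rcases lt_or_ge q 0 with h0 | h0
  · have h1 : Iic q ∩ Icc (0 : ℝ) 1 = ∅ := by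
      ext u; simp only [mem_inter_iff, mem_Iic, mem_Icc, mem_empty_iff_false, iff_false]
      intro h; linarith [h.1, h.2.1]
    have h2 : (candidate μ) {x | quantileSample μ x ≤ q} = 0 := by
      refine measure_eq_zero_iff_ae_notMem.2 ?_
      filter_upwards [hmem] with x hx h
      exact absurd (hx.1.trans h) (not_le.2 h0)
    rw [h1, measureReal_def, h2]; simp
  rcases lt_or_ge q 1 with h1 | h1
  · have hI : Iic q ∩ Icc (0 : ℝ) 1 = Icc 0 q := by
      ext u; simp only [mem_inter_iff, mem_Iic, mem_Icc]
      exact ⟨fun h => ⟨h.2.1, h.1⟩, fun h => ⟨h.2, h.1, h.2.trans h1.le⟩⟩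
    rw [hIic q ⟨h0, h1⟩, hI, Real.volume_real_Icc_of_le h0, sub_zero]
  · have hI : Iic q ∩ Icc (0 : ℝ) 1 = Icc 0 1 := inter_eq_right.2 fun u hu => hu.2.trans h1
    have h2 : (candidate μ) {x | quantileSample μ x ≤ q} = 1 := by
      refine (mem_ae_iff_prob_eq_one (hm measurableSet_Iic)).1 ?_
      filter_upwards [hmem] with x hx using hx.2.trans h1
    rw [hI, measureReal_def, h2]; simp

end Quantile

/-! ### Counting successes in independent trials -/

section Counting

variable {Ω : Type*} {k : ℕ}

open Classical in
/-- The number of coordinates that lie in `A`. -/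
def count (A : Set Ω) (ω : Fin k → Ω) : ℕ := (Finset.univ.filter fun i => ω i ∈ A).card

lemma count_eq_sum (A : Set Ω) (ω : Fin k → Ω) :
    (count A ω : ℝ) = ∑ i, A.indicator (fun _ => (1 : ℝ)) (ω i) := by
  classical
  simp [count, indicator_apply]

lemma count_le (A : Set Ω) (ω : Fin k → Ω) : count A ω ≤ k := by
  classical
  simpa [count] using (Finset.univ.filter fun i => ω i ∈ A).card_le_univ

lemma indicator_one_mem_Icc (A : Set Ω) (x : Ω) :
    A.indicator (fun _ => (1 : ℝ)) x ∈ Icc (0 : ℝ) 1 := by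
  by_cases h : x ∈ A <;> simp [h]

variable [MeasurableSpace Ω] {ν : Measure Ω}

lemma measurable_count {A : Set Ω} (hA : MeasurableSet A) :
    Measurable fun ω : Fin k → Ω => (count A ω : ℝ) := by
  simp_rw [count_eq_sum]
  exact Finset.measurable_sum _ fun i _ =>
    (measurable_const.indicator hA).comp (measurable_pi_apply i)

lemma integral_indicator_eq_measureReal {A : Set Ω} (hA : MeasurableSet A) :
    ∫ x, A.indicator (fun _ => (1 : ℝ)) x ∂ν = ν.real A := by
  rw [integral_indicator_const _ hA]; simp

variable [IsProbabilityMeasure ν]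

/-- Hoeffding's inequality for the number of successes. -/
lemma measureReal_le_count_le {A : Set Ω} (hA : MeasurableSet A) {b ε : ℝ} (hε : 0 ≤ ε)
    (h : k * ν.real A + ε ≤ b) :
    (Measure.pi fun _ : Fin k => ν).real {ω | b ≤ count A ω} ≤ Real.exp (-(2 * ε ^ 2 / k)) := by
  set f : Ω → ℝ := A.indicator (fun _ => (1 : ℝ)) with hf
  have hfm : Measurable f := measurable_const.indicator hA
  have hind : iIndepFun (fun (i : Fin k) (ω : Fin k → Ω) => f (ω i) - ν.real A)
      (Measure.pi fun _ : Fin k => ν) :=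
    iIndepFun_pi (X := fun _ x => f x - ν.real A) fun _ => (hfm.sub_const _).aemeasurable
  have hsub : ∀ i ∈ (Finset.univ : Finset (Fin k)),
      HasSubgaussianMGF (fun (ω : Fin k → Ω) => f (ω i) - ν.real A)
        ((‖(1 : ℝ) - 0‖₊ / 2) ^ 2) (Measure.pi fun _ : Fin k => ν) := by
    intro i _
    have hmp := measurePreserving_eval (fun _ : Fin k => ν) i
    have := hasSubgaussianMGF_of_mem_Icc (μ := Measure.pi fun _ : Fin k => ν)
      (X := fun ω => f (ω i)) (a := 0) (b := 1)
      (hfm.comp (measurable_pi_apply i)).aemeasurable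
      (Filter.Eventually.of_forall fun ω => indicator_one_mem_Icc A (ω i))
    rwa [integral_comp_eval (μ := fun _ : Fin k => ν) hfm.aestronglyMeasurable,
      integral_indicator_eq_measureReal hA] at this
  have hmain := HasSubgaussianMGF.measure_sum_ge_le_of_iIndepFun hind hsub hε
  refine le_trans (measureReal_mono ?_) (hmain.trans (le_of_eq ?_))
  · intro ω hω
    change b ≤ (count A ω : ℝ) at hω
    change ε ≤ ∑ i, (f (ω i) - ν.real A)
    rw [Finset.sum_sub_distrib, ← count_eq_sum]
    simp only [Finset.sum_const, Finset.card_univ, Fintype.card_fin, nsmul_eq_mul]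
    linarith
  · congr 1
    simp
    rcases Nat.eq_zero_or_pos k with rfl | hk
    · simp
    · have : (k : ℝ) ≠ 0 := by positivity
      field_simp

lemma memLp_indicator_one {A : Set Ω} (hA : MeasurableSet A) :
    MemLp (A.indicator fun _ => (1 : ℝ)) 2 ν :=
  memLp_of_bounded (Filter.Eventually.of_forall fun x => indicator_one_mem_Icc A x)
    (measurable_const.indicator hA).aestronglyMeasurable 2

lemma integrable_count {A : Set Ω} (hA : MeasurableSet A) :
    Integrable (fun ω : Fin k → Ω => (count A ω : ℝ)) (Measure.pi fun _ : Fin k => ν) := by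
  refine (integrable_const (k : ℝ)).mono' (measurable_count hA).aestronglyMeasurable
    (Filter.Eventually.of_forall fun ω => ?_)
  rw [Real.norm_of_nonneg (by positivity)]
  exact_mod_cast count_le A ω

lemma integral_count {A : Set Ω} (hA : MeasurableSet A) :
    ∫ ω, (count A ω : ℝ) ∂(Measure.pi fun _ : Fin k => ν) = k * ν.real A := by
  have hfm : Measurable (A.indicator fun _ => (1 : ℝ)) := measurable_const.indicator hA
  simp_rw [count_eq_sum]
  rw [integral_finsetSum]
  · simp_rw [integral_comp_eval (μ := fun _ : Fin k => ν) hfm.aestronglyMeasurable,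
      integral_indicator_eq_measureReal hA]
    simp
  · intro i _
    exact integrable_comp_eval (μ := fun _ : Fin k => ν)
      ((memLp_indicator_one hA).integrable (by norm_num))

lemma integral_sq_count_sub_le {A : Set Ω} (hA : MeasurableSet A) :
    ∫ ω, ((count A ω : ℝ) - k * ν.real A) ^ 2 ∂(Measure.pi fun _ : Fin k => ν) ≤ k / 4 := by
  have h := variance_sum_pi (μ := fun _ : Fin k => ν)
    (X := fun _ => A.indicator fun _ => (1 : ℝ)) fun _ => memLp_indicator_one hA
  have hfun : (∑ i : Fin k, fun ω : Fin k → Ω => A.indicator (fun _ => (1 : ℝ)) (ω i))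
      = fun ω => (count A ω : ℝ) := by
    ext ω; rw [Finset.sum_apply, count_eq_sum]
  rw [hfun, variance_eq_integral (measurable_count hA).aemeasurable, integral_count hA] at h
  rw [h]
  have hv : Var[A.indicator fun _ => (1 : ℝ); ν] ≤ ((1 - 0) / 2) ^ 2 :=
    variance_le_sq_of_bounded (Filter.Eventually.of_forall fun x => indicator_one_mem_Icc A x)
      (measurable_const.indicator hA).aemeasurable
  simp only [Finset.sum_const, Finset.card_univ, Fintype.card_fin, nsmul_eq_mul]
  have : (0 : ℝ) ≤ k := by positivity
  nlinarith

lemma integrable_count_excess {A : Set Ω} (hA : MeasurableSet A) (b : ℝ) :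
    Integrable (fun ω : Fin k → Ω => max ((count A ω : ℝ) - b) 0)
      (Measure.pi fun _ : Fin k => ν) :=
  ((integrable_count hA).sub (integrable_const b)).pos_part

/-- The expected number of successes above the mean is at most of the order of the standard
deviation. -/
lemma integral_count_excess_le {A : Set Ω} (hA : MeasurableSet A) {b : ℝ}
    (h : k * ν.real A = b) :
    ∫ ω, max ((count A ω : ℝ) - b) 0 ∂(Measure.pi fun _ : Fin k => ν) ≤ Real.sqrt k := by
  rcases Nat.eq_zero_or_pos k with rfl | hk
  · have : ∀ ω : Fin 0 → Ω, max ((count A ω : ℝ) - b) 0 = 0 := by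
      intro ω
      have : count A ω = 0 := Nat.le_zero.1 (count_le A ω)
      rw [this, ← h]; simp
    simp [this]
  have hc : 0 < Real.sqrt k := Real.sqrt_pos.2 (by exact_mod_cast hk)
  have hsq : Real.sqrt k ^ 2 = k := Real.sq_sqrt (by positivity)
  set c := Real.sqrt k
  have hint : Integrable (fun ω : Fin k → Ω => ((count A ω : ℝ) - b) ^ 2)
      (Measure.pi fun _ : Fin k => ν) := by
    refine (integrable_const ((k + |b|) ^ 2 : ℝ)).mono'
      (((measurable_count hA).sub_const b).pow_const 2).aestronglyMeasurable
      (Filter.Eventually.of_forall fun ω => ?_)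
    rw [Real.norm_of_nonneg (by positivity), ← sq_abs ((count A ω : ℝ) - b)]
    have h1 : |(count A ω : ℝ) - b| ≤ k + |b| := by
      refine (abs_sub _ _).trans (add_le_add ?_ le_rfl)
      rw [abs_of_nonneg (by positivity)]
      exact_mod_cast count_le A ω
    gcongr
  -- With `c = √k`, the inequality `max y 0 ≤ y²/(2c) + c/2` and the variance bound `k/4` give `c/8
  -- + c/2 ≤ c`.
  calc ∫ ω, max ((count A ω : ℝ) - b) 0 ∂(Measure.pi fun _ : Fin k => ν)
      ≤ ∫ ω, (((count A ω : ℝ) - b) ^ 2 * (1 / (2 * c)) + c / 2)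
          ∂(Measure.pi fun _ : Fin k => ν) := by
        refine integral_mono (integrable_count_excess hA b)
          ((hint.mul_const _).add (integrable_const _)) fun ω => ?_
        set y := (count A ω : ℝ) - b
        have hy : y ^ 2 * (1 / (2 * c)) + c / 2 = (y ^ 2 + c ^ 2) / (2 * c) := by
          field_simp
        change max y 0 ≤ y ^ 2 * (1 / (2 * c)) + c / 2
        rw [hy, le_div_iff₀ (by positivity)]
        rcases max_cases y 0 with ⟨h, -⟩ | ⟨h, -⟩ <;> rw [h] <;>
          nlinarith [sq_nonneg (y - c), sq_nonneg y, sq_nonneg c]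
    _ = (∫ ω, ((count A ω : ℝ) - b) ^ 2 ∂(Measure.pi fun _ : Fin k => ν)) * (1 / (2 * c))
          + c / 2 := by
        rw [integral_add (hint.mul_const _) (integrable_const _), integral_mul_const]
        simp
    _ ≤ (k / 4) * (1 / (2 * c)) + c / 2 := by
        have := integral_sq_count_sub_le (ν := ν) (k := k) hA
        rw [h] at this
        gcongr
    _ ≤ c := by
        rw [← hsq]; field_simp; nlinarith

end Counting

/-! ### Candidates described by quantiles -/

section Candidates

variable {Ω : Type*} [MeasurableSpace Ω]

/-- Under `ν`, the quantile `X` is uniform and the ability is `θ = G (X)` for a monotone `G` with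
values in `[0,1]`. -/
structure IsQuantileCoupling (ν : Measure Ω) (θ X : Ω → ℝ) (G : ℝ → ℝ) : Prop where
  measurable_ability : Measurable θ
  measurable_sample : Measurable X
  uniform : ν.map X = volume.restrict (Icc (0 : ℝ) 1)
  ability_eq : ∀ᵐ x ∂ν, θ x = G (X x)
  mem_Icc : ∀ q ≤ 1, G q ∈ Icc (0 : ℝ) 1
  mono : ∀ q r, q ≤ r → r ≤ 1 → G q ≤ G r

lemma isQuantileCoupling_candidate {μ : Measure ℝ} [IsProbabilityMeasure μ]
    (hμ : μ (Icc (0 : ℝ) 1)ᶜ = 0) :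
    IsQuantileCoupling (candidate μ) Prod.fst (quantileSample μ) (quantile μ) where
  measurable_ability := measurable_fst
  measurable_sample := measurable_quantileSample hμ
  uniform := map_quantileSample hμ
  ability_eq := by
    filter_upwards [ae_candidate hμ] with x hx
    exact (quantile_quantileSample hμ hx.1 hx.2.1 hx.2.2).symm
  mem_Icc _ hq := quantile_mem_Icc hμ hq
  mono _ _ h hr := quantile_mono hμ hr h

namespace IsQuantileCoupling

variable {ν : Measure Ω} {θ X : Ω → ℝ} {G : ℝ → ℝ}

lemma measureReal_preimage (h : IsQuantileCoupling ν θ X G) {s : Set ℝ} (hs : MeasurableSet s) :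
    ν.real (X ⁻¹' s) = volume.real (s ∩ Icc 0 1) := by
  rw [← map_measureReal_apply h.measurable_sample hs, h.uniform, measureReal_restrict_apply hs]

lemma ae_sample (h : IsQuantileCoupling ν θ X G) {s : Set ℝ}
    (hs : volume (sᶜ ∩ Icc 0 1) = 0) : ∀ᵐ x ∂ν, X x ∈ s := by
  have h1 : ∀ᵐ y ∂(ν.map X), y ∈ s := by
    rw [h.uniform, ae_restrict_iff' measurableSet_Icc, ae_iff]
    convert hs using 2
    ext y; simp; tauto
  exact ae_of_ae_map h.measurable_sample.aemeasurable h1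

lemma ae_sample_mem (h : IsQuantileCoupling ν θ X G) : ∀ᵐ x ∂ν, X x ∈ Ioc (0 : ℝ) 1 := by
  refine h.ae_sample (measure_mono_null (t := {0}) ?_ (by simp))
  rintro y ⟨h1, h2⟩
  by_contra h3
  exact h1 ⟨lt_of_le_of_ne h2.1 (Ne.symm h3), h2.2⟩

lemma ae_sample_notMem (h : IsQuantileCoupling ν θ X G) {N : Set ℝ} (hN : N.Countable) :
    ∀ᵐ x ∂ν, X x ∉ N :=
  h.ae_sample (s := Nᶜ) (measure_mono_null (t := N) (by rintro y ⟨h1, -⟩; simpa using h1)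
    (hN.measure_zero _))

lemma ae_ability_mem (h : IsQuantileCoupling ν θ X G) : ∀ᵐ x ∂ν, θ x ∈ Icc (0 : ℝ) 1 := by
  filter_upwards [h.ability_eq, h.ae_sample_mem] with x h1 h2
  rw [h1]; exact h.mem_Icc _ h2.2

lemma measureReal_le (h : IsQuantileCoupling ν θ X G) {u : ℝ} (hu : 0 ≤ u) :
    ν.real (X ⁻¹' Iic u) ≤ u := by
  rw [h.measureReal_preimage measurableSet_Iic]
  calc volume.real (Iic u ∩ Icc 0 1) ≤ volume.real (Icc 0 u) :=
        measureReal_mono (fun y hy => ⟨hy.2.1, hy.1⟩) (by simp)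
    _ = u := by rw [Real.volume_real_Icc_of_le hu, sub_zero]

lemma measureReal_ge (h : IsQuantileCoupling ν θ X G) {v : ℝ} (hv : v ≤ 1) :
    ν.real (X ⁻¹' Ici v) ≤ 1 - v := by
  rw [h.measureReal_preimage measurableSet_Ici]
  calc volume.real (Ici v ∩ Icc 0 1) ≤ volume.real (Icc v 1) :=
        measureReal_mono (fun y hy => ⟨hy.1, hy.2.2⟩) (by simp)
    _ = 1 - v := Real.volume_real_Icc_of_le hv

lemma measureReal_ge_eq (h : IsQuantileCoupling ν θ X G) {v : ℝ} (hv : v ∈ Icc (0 : ℝ) 1) :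
    ν.real (X ⁻¹' Ici v) = 1 - v := by
  rw [h.measureReal_preimage measurableSet_Ici]
  have : Ici v ∩ Icc (0 : ℝ) 1 = Icc v 1 := by
    ext y; simp only [mem_inter_iff, mem_Ici]
    exact ⟨fun h => ⟨h.1, h.2.2⟩, fun h => ⟨h.1, hv.1.trans h.1, h.2⟩⟩
  rw [this, Real.volume_real_Icc_of_le hv.2]

lemma measureReal_Icc_le (h : IsQuantileCoupling ν θ X G) {u v : ℝ} (huv : u ≤ v) :
    ν.real (X ⁻¹' Icc u v) ≤ v - u := by
  rw [h.measureReal_preimage measurableSet_Icc]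
  calc volume.real (Icc u v ∩ Icc 0 1) ≤ volume.real (Icc u v) :=
        measureReal_mono inter_subset_left (by simp)
    _ = v - u := Real.volume_real_Icc_of_le huv

end IsQuantileCoupling

end Candidates

/-! ### Values of threshold policies by backward recursion -/

section Values

variable {Ω : Type*}

/-- The total ability hired from `m` candidates with budget `b` and the constant threshold `c`. -/
def staticValue (θ X : Ω → ℝ) (c : ℝ) : (m : ℕ) → ℕ → (Fin m → Ω) → ℝ
  | 0, _, _ => 0
  | m + 1, b, ω =>
    if c ≤ X (ω 0) ∧ 0 < b then θ (ω 0) + staticValue θ X c m (b - 1) (Fin.tail ω)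
    else staticValue θ X c m b (Fin.tail ω)

/-- The total ability hired from `m` candidates with budget `b`, when the threshold with `j`
candidates left and budget `a` is `p j a` for `j > m₀`, and is frozen at its certainty-equivalent
value as soon as at most `m₀` candidates are left. -/
def twoPhaseValue (θ X : Ω → ℝ) (m₀ : ℕ) (p : ℕ → ℕ → ℝ) : (m : ℕ) → ℕ → (Fin m → Ω) → ℝ
  | 0, _, _ => 0
  | m + 1, b, ω =>
    if m + 1 ≤ m₀ then staticValue θ X (1 - b / ((m + 1 : ℕ) : ℝ)) (m + 1) b ω
    else if p (m + 1) b ≤ X (ω 0) ∧ 0 < b then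
      θ (ω 0) + twoPhaseValue θ X m₀ p m (b - 1) (Fin.tail ω)
    else twoPhaseValue θ X m₀ p m b (Fin.tail ω)

variable {θ X : Ω → ℝ}

lemma staticValue_zero_budget (c : ℝ) (m : ℕ) (ω : Fin m → Ω) :
    staticValue θ X c m 0 ω = 0 := by
  induction m with
  | zero => rfl
  | succ m ih => simp [staticValue, ih]

lemma twoPhaseValue_zero_budget (m₀ : ℕ) (p : ℕ → ℕ → ℝ) (m : ℕ) (ω : Fin m → Ω) :
    twoPhaseValue θ X m₀ p m 0 ω = 0 := by
  induction m with
  | zero => rfl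
  | succ m ih =>
    unfold twoPhaseValue
    split_ifs with h1 h2
    · exact staticValue_zero_budget _ _ _
    · omega
    · exact ih _

lemma abs_staticValue_le (c : ℝ) (m b : ℕ) (ω : Fin m → Ω) :
    |staticValue θ X c m b ω| ≤ ∑ i, |θ (ω i)| := by
  induction m generalizing b with
  | zero => simp [staticValue]
  | succ m ih =>
    rw [Fin.sum_univ_succ]
    unfold staticValue
    split_ifs with h
    · exact (abs_add_le _ _).trans (add_le_add le_rfl (ih _ _))
    · exact (ih _ _).trans (le_add_of_nonneg_left (abs_nonneg _))

lemma abs_twoPhaseValue_le (m₀ : ℕ) (p : ℕ → ℕ → ℝ) (m b : ℕ) (ω : Fin m → Ω) :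
    |twoPhaseValue θ X m₀ p m b ω| ≤ ∑ i, |θ (ω i)| := by
  induction m generalizing b with
  | zero => simp [twoPhaseValue]
  | succ m ih =>
    unfold twoPhaseValue
    split_ifs with h1 h
    · exact abs_staticValue_le _ _ _ _
    · rw [Fin.sum_univ_succ]
      exact (abs_add_le _ _).trans (add_le_add le_rfl (ih _ _))
    · rw [Fin.sum_univ_succ]
      exact (ih _ _).trans (le_add_of_nonneg_left (abs_nonneg _))

/-- A constant threshold loses at most one for each candidate above it who finds the budget
exhausted. -/
lemma sum_sub_excess_le_staticValue (c : ℝ) (m b : ℕ) (ω : Fin m → Ω)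
    (h1 : ∀ i, θ (ω i) ≤ 1) :
    ∑ i, (X ⁻¹' Ici c).indicator θ (ω i) - max ((count (X ⁻¹' Ici c) ω : ℝ) - b) 0
      ≤ staticValue θ X c m b ω := by
  simp_rw [count_eq_sum]
  induction m generalizing b with
  | zero => simp [staticValue]
  | succ m ih =>
    rw [Fin.sum_univ_succ, Fin.sum_univ_succ]
    have ht : ∀ i, θ (Fin.tail ω i) ≤ 1 := fun i => h1 _
    by_cases hX : c ≤ X (ω 0)
    · rw [indicator_of_mem (show ω 0 ∈ X ⁻¹' Ici c from hX),
        indicator_of_mem (show ω 0 ∈ X ⁻¹' Ici c from hX)]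
      rcases Nat.eq_zero_or_pos b with rfl | hb
      · have := ih 0 (Fin.tail ω) ht
        rw [staticValue_zero_budget] at this ⊢
        have hn : 0 ≤ ∑ i, (X ⁻¹' Ici c).indicator (fun _ => (1 : ℝ)) (Fin.tail ω i) :=
          Finset.sum_nonneg fun i _ => (indicator_one_mem_Icc _ _).1
        simp only [Fin.tail, Nat.cast_zero, sub_zero] at this hn ⊢
        rw [max_eq_left hn] at this
        rw [max_eq_left (by linarith)]
        linarith [h1 0]
      · have := ih (b - 1) (Fin.tail ω) ht
        rw [Nat.cast_sub hb, Nat.cast_one] at this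
        rw [staticValue, if_pos ⟨hX, hb⟩]
        simp only [Fin.tail] at this ⊢
        rw [show ∀ y z : ℝ, 1 + y - z = y - (z - 1) by intros; ring]
        linarith
    · rw [indicator_of_notMem (show ω 0 ∉ X ⁻¹' Ici c from hX),
        indicator_of_notMem (show ω 0 ∉ X ⁻¹' Ici c from hX), staticValue,
        if_neg (fun h => hX h.1), zero_add, zero_add]
      exact ih b (Fin.tail ω) ht

variable [MeasurableSpace Ω]

lemma measurable_tail (m : ℕ) :
    Measurable (Fin.tail : (Fin (m + 1) → Ω) → (Fin m → Ω)) :=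
  measurable_pi_lambda _ fun i => measurable_pi_apply i.succ

lemma measurable_staticValue (hθ : Measurable θ) (hX : Measurable X) (c : ℝ) (m b : ℕ) :
    Measurable fun ω : Fin m → Ω => staticValue θ X c m b ω := by
  induction m generalizing b with
  | zero => exact measurable_const
  | succ m ih =>
    unfold staticValue
    have h0 : Measurable fun ω : Fin (m + 1) → Ω => ω 0 := measurable_pi_apply 0
    refine Measurable.ite ?_ ((hθ.comp h0).add ((ih _).comp (measurable_tail m)))
      ((ih _).comp (measurable_tail m))
    exact (measurableSet_le measurable_const (hX.comp h0)).inter (MeasurableSet.const _)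

lemma measurable_twoPhaseValue (hθ : Measurable θ) (hX : Measurable X) (m₀ : ℕ)
    (p : ℕ → ℕ → ℝ) (m b : ℕ) :
    Measurable fun ω : Fin m → Ω => twoPhaseValue θ X m₀ p m b ω := by
  induction m generalizing b with
  | zero => exact measurable_const
  | succ m ih =>
    unfold twoPhaseValue
    have h0 : Measurable fun ω : Fin (m + 1) → Ω => ω 0 := measurable_pi_apply 0
    by_cases h : m + 1 ≤ m₀
    · simp_rw [if_pos h]
      exact measurable_staticValue hθ hX _ _ _
    · simp_rw [if_neg h]
      refine Measurable.ite ?_ ((hθ.comp h0).add ((ih _).comp (measurable_tail m)))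
        ((ih _).comp (measurable_tail m))
      exact (measurableSet_le measurable_const (hX.comp h0)).inter (MeasurableSet.const _)

end Values

/-! ### Expected gap to the offline optimum: the frozen phase and the full-budget case -/

section Recursion

variable {Ω : Type*} [MeasurableSpace Ω] {ν : Measure Ω} [IsProbabilityMeasure ν]
  {θ X : Ω → ℝ} {G : ℝ → ℝ}

lemma ae_forall_pi {P : Ω → Prop} (h : ∀ᵐ x ∂ν, P x) (k : ℕ) :
    ∀ᵐ ω ∂(Measure.pi fun _ : Fin k => ν), ∀ i, P (ω i) :=
  ae_all_iff.2 fun i =>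
    (measurePreserving_eval (fun _ : Fin k => ν) i).quasiMeasurePreserving.ae h

lemma measurePreserving_cons (k : ℕ) :
    MeasurePreserving (fun z : Ω × (Fin k → Ω) => (Fin.cons z.1 z.2 : Fin (k + 1) → Ω))
      (ν.prod (Measure.pi fun _ : Fin k => ν)) (Measure.pi fun _ : Fin (k + 1) => ν) := by
  have h := (measurePreserving_piFinSuccAbove (fun _ : Fin (k + 1) => ν) 0).symm
  convert h using 1
  ext z : 1
  simp [MeasurableEquiv.piFinSuccAbove_symm_apply, Fin.insertNthEquiv]

lemma integral_cons (k : ℕ) {f : (Fin (k + 1) → Ω) → ℝ} (hf : Measurable f) :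
    ∫ ω, f ω ∂(Measure.pi fun _ : Fin (k + 1) => ν)
      = ∫ z, f (Fin.cons z.1 z.2) ∂(ν.prod (Measure.pi fun _ : Fin k => ν)) := by
  rw [← (measurePreserving_cons (ν := ν) k).map_eq,
    integral_map (measurePreserving_cons (ν := ν) k).measurable.aemeasurable
      hf.aestronglyMeasurable]

/-- The difference of the offline value and the value of the two-phase policy. -/
def valueGap (θ X : Ω → ℝ) (m₀ : ℕ) (p : ℕ → ℕ → ℝ) (m b : ℕ) (ω : Fin m → Ω) : ℝ :=
  offlineValue b (fun i => θ (ω i)) - twoPhaseValue θ X m₀ p m b ω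

namespace IsQuantileCoupling

variable {m₀ : ℕ} {p : ℕ → ℕ → ℝ}

lemma measurable_valueGap (hc : IsQuantileCoupling ν θ X G) (m b : ℕ) :
    Measurable (valueGap θ X m₀ p m b) :=
  ((measurable_offlineValue b).comp (measurable_pi_lambda _ fun i =>
    hc.measurable_ability.comp (measurable_pi_apply i))).sub
    (measurable_twoPhaseValue hc.measurable_ability hc.measurable_sample m₀ p m b)

lemma integrable_valueGap (hc : IsQuantileCoupling ν θ X G) (m b : ℕ) :
    Integrable (valueGap θ X m₀ p m b) (Measure.pi fun _ : Fin m => ν) := by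
  refine (integrable_const (2 * m : ℝ)).mono' (hc.measurable_valueGap m b).aestronglyMeasurable ?_
  filter_upwards [ae_forall_pi hc.ae_ability_mem m] with ω hω
  have hs : ∑ i, |θ (ω i)| ≤ m := by
    calc ∑ i, |θ (ω i)| ≤ ∑ _i : Fin m, (1 : ℝ) := Finset.sum_le_sum fun i _ => by
          rw [abs_of_nonneg (hω i).1]; exact (hω i).2
      _ = m := by simp
  calc ‖valueGap θ X m₀ p m b ω‖ ≤ |offlineValue b fun i => θ (ω i)|
        + |twoPhaseValue θ X m₀ p m b ω| := abs_sub _ _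
    _ ≤ 2 * m := by
      linarith [abs_offlineValue_le b fun i => θ (ω i),
        abs_twoPhaseValue_le (θ := θ) (X := X) m₀ p m b ω]

lemma integral_valueGap_zero_budget (m : ℕ) :
    ∫ ω, valueGap θ X m₀ p m 0 ω ∂(Measure.pi fun _ : Fin m => ν) = 0 := by
  simp [valueGap, offlineValue_zero, twoPhaseValue_zero_budget]

/-- A constant certainty-equivalent threshold has regret of the order of `√m`. -/
lemma integral_offlineValue_sub_staticValue_le (hc : IsQuantileCoupling ν θ X G) {m b : ℕ}
    (hm : 0 < m) (hb : b ≤ m) :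
    ∫ ω, (offlineValue b (fun i => θ (ω i)) - staticValue θ X (1 - b / (m : ℝ)) m b ω)
      ∂(Measure.pi fun _ : Fin m => ν) ≤ Real.sqrt m := by
  have hm' : (0 : ℝ) < m := by exact_mod_cast hm
  have hb' : (b : ℝ) ≤ m := by exact_mod_cast hb
  set c : ℝ := 1 - b / (m : ℝ) with hcdef
  have hdiv : (b : ℝ) / m ≤ 1 := (div_le_one hm').2 hb'
  have hc01 : c ∈ Icc (0 : ℝ) 1 := ⟨by linarith, sub_le_self _ (by positivity)⟩
  set A : Set Ω := X ⁻¹' Ici c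
  have hA : MeasurableSet A := hc.measurable_sample measurableSet_Ici
  have hνA : m * ν.real A = b := by
    rw [hc.measureReal_ge_eq hc01, hcdef]; field_simp; ring
  set g := G c
  have hg := hc.mem_Icc c hc01.2
  -- Lagrangian bound at the price `g = G c`: by monotonicity of `G` the candidates with positive
  -- surplus are among those with `X ≥ c`, so the hired abilities cancel. The term in `b - count`
  -- has mean zero by the choice of `c`; only the excess over the budget remains.
  have hpt : ∀ᵐ ω ∂(Measure.pi fun _ : Fin m => ν),
      offlineValue b (fun i => θ (ω i)) - staticValue θ X c m b ω
        ≤ g * (b - count A ω) + max ((count A ω : ℝ) - b) 0 := by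
    filter_upwards [ae_forall_pi hc.ae_ability_mem m, ae_forall_pi hc.ability_eq m,
      ae_forall_pi hc.ae_sample_mem m] with ω h1 h2 h3
    have hstat := sum_sub_excess_le_staticValue (θ := θ) (X := X) c m b ω fun i => (h1 i).2
    have hoff := offlineValue_le_lagrangian b (fun i => θ (ω i)) hg.1
    have hsum : ∑ i, max (θ (ω i) - g) 0 = ∑ i, A.indicator θ (ω i) - g * count A ω := by
      rw [count_eq_sum, Finset.mul_sum, ← Finset.sum_sub_distrib]
      refine Finset.sum_congr rfl fun i _ => ?_
      by_cases hi : ω i ∈ A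
      · rw [indicator_of_mem hi, indicator_of_mem hi, mul_one, max_eq_left]
        rw [h2 i]
        exact sub_nonneg.2 (hc.mono _ _ hi (h3 i).2)
      · rw [indicator_of_notMem hi, indicator_of_notMem hi, mul_zero, sub_zero, max_eq_right]
        rw [h2 i]
        exact sub_nonpos.2 (hc.mono _ _ (not_le.1 hi).le hc01.2)
    rw [hsum] at hoff
    linarith
  have hcount := integrable_count (ν := ν) (k := m) hA
  have hexc := integrable_count_excess (ν := ν) (k := m) hA b
  have hlin : Integrable (fun ω : Fin m → Ω => g * ((b : ℝ) - count A ω))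
      (Measure.pi fun _ : Fin m => ν) := ((integrable_const _).sub hcount).const_mul g
  have hint : Integrable (fun ω : Fin m → Ω =>
      offlineValue b (fun i => θ (ω i)) - staticValue θ X c m b ω)
      (Measure.pi fun _ : Fin m => ν) := by
    -- With `m₀ = m` the two-phase policy is frozen from the start, so the integrand is a
    -- `valueGap`.
    have := hc.integrable_valueGap (m₀ := m) (p := fun _ _ => 0) m b
    convert this using 2 with ω
    obtain ⟨k, rfl⟩ : ∃ k, m = k + 1 := ⟨m - 1, by omega⟩
    rw [valueGap, twoPhaseValue, if_pos le_rfl]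
  calc _ ≤ ∫ ω, (g * ((b : ℝ) - count A ω) + max ((count A ω : ℝ) - b) 0)
        ∂(Measure.pi fun _ : Fin m => ν) := integral_mono_ae hint (hlin.add hexc) hpt
    _ = 0 + ∫ ω, max ((count A ω : ℝ) - b) 0 ∂(Measure.pi fun _ : Fin m => ν) := by
        rw [integral_add hlin hexc, integral_const_mul, integral_sub (integrable_const _) hcount,
          integral_count hA, hνA]
        simp
    _ ≤ Real.sqrt m := by rw [zero_add]; exact integral_count_excess_le hA hνA

lemma integral_valueGap_le_of_static (hc : IsQuantileCoupling ν θ X G) {b : ℕ} (hb : b ≤ m₀) :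
    ∫ ω, valueGap θ X m₀ p m₀ b ω ∂(Measure.pi fun _ : Fin m₀ => ν) ≤ Real.sqrt m₀ := by
  rcases Nat.eq_zero_or_pos m₀ with rfl | hm
  · have : b = 0 := by omega
    subst this
    rw [integral_valueGap_zero_budget]; exact Real.sqrt_nonneg _
  · refine le_of_eq_of_le ?_ (hc.integral_offlineValue_sub_staticValue_le hm hb)
    refine integral_congr_ae (Filter.Eventually.of_forall fun ω => ?_)
    obtain ⟨k, rfl⟩ : ∃ k, m₀ = k + 1 := ⟨m₀ - 1, by omega⟩
    simp only [valueGap, twoPhaseValue, le_refl, if_true]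

lemma cons_comp (k : ℕ) (z : Ω × (Fin k → Ω)) :
    (fun i => θ ((Fin.cons z.1 z.2 : Fin (k + 1) → Ω) i))
      = (Fin.cons (θ z.1) (fun i => θ (z.2 i)) : Fin (k + 1) → ℝ) := by
  ext i
  refine Fin.cases ?_ (fun j => ?_) i <;> simp

/-- With as many candidates as units of budget, hiring costs nothing. -/
lemma integral_valueGap_full_le (hc : IsQuantileCoupling ν θ X G) {k : ℕ} (hk : m₀ ≤ k)
    (hp : p (k + 1) (k + 1) ≤ 0) :
    ∫ ω, valueGap θ X m₀ p (k + 1) (k + 1) ω ∂(Measure.pi fun _ : Fin (k + 1) => ν)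
      ≤ ∫ ω, valueGap θ X m₀ p k k ω ∂(Measure.pi fun _ : Fin k => ν) := by
  have hsnd : ∫ ω, valueGap θ X m₀ p k k ω ∂(Measure.pi fun _ : Fin k => ν)
      = ∫ z, valueGap θ X m₀ p k k z.2 ∂(ν.prod (Measure.pi fun _ : Fin k => ν)) := by
    rw [integral_fun_snd]; simp
  rw [hsnd, integral_cons k (hc.measurable_valueGap _ _)]
  refine integral_mono_ae
    ((measurePreserving_cons k).integrable_comp_of_integrable (hc.integrable_valueGap _ _))
    ((hc.integrable_valueGap k k).comp_snd ν) ?_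
  filter_upwards [Measure.quasiMeasurePreserving_fst.ae hc.ae_ability_mem,
    Measure.quasiMeasurePreserving_fst.ae hc.ae_sample_mem] with z h1 h2
  have hoff := offlineValue_cons_le k (θ z.1) (fun i => θ (z.2 i))
  -- A unit of budget beyond the number of candidates is worthless, so hiring is optimal for any
  -- nonnegative ability.
  have hfull := offlineValue_succ_card (fun i => θ (z.2 i))
  have hmax : max (offlineValue (k + 1) fun i => θ (z.2 i))
      (θ z.1 + offlineValue k fun i => θ (z.2 i)) ≤ θ z.1 + offlineValue k fun i => θ (z.2 i) :=
    max_le (by linarith [h1.1]) le_rfl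
  simp only [valueGap]
  rw [cons_comp, twoPhaseValue, if_neg (by omega)]
  simp only [Fin.cons_zero, Fin.tail_cons]
  rw [if_pos ⟨hp.trans h2.1.le, Nat.succ_pos k⟩]
  simp only [Nat.add_sub_cancel]
  linarith

end IsQuantileCoupling

end Recursion

/-! ### Loss of one decision and summation of the losses -/

section Step

variable {Ω : Type*} [MeasurableSpace Ω] {ν : Measure Ω} [IsProbabilityMeasure ν]
  {θ X : Ω → ℝ} {G : ℝ → ℝ}

namespace IsQuantileCoupling

variable {m₀ : ℕ} {p : ℕ → ℕ → ℝ}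

/-- The paths on which the empirical quantile for `b + 1` hires out of `k` candidates is not
between `u` and `v`. -/
def atypical (X : Ω → ℝ) (k b : ℕ) (u v : ℝ) : Set (Fin k → Ω) :=
  {ω | ((b + 1 : ℕ) : ℝ) ≤ count (X ⁻¹' Ici v) ω} ∪
    {ω | ((k : ℝ) - b) ≤ count (X ⁻¹' Iic u) ω}

lemma measurableSet_atypical (hc : IsQuantileCoupling ν θ X G) (k b : ℕ) (u v : ℝ) :
    MeasurableSet (atypical X k b u v) :=
  (measurableSet_le measurable_const
    (measurable_count (hc.measurable_sample measurableSet_Ici))).union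
    (measurableSet_le measurable_const
    (measurable_count (hc.measurable_sample measurableSet_Iic)))

/-- Covers levels outside `[0,1]`, where the linear bounds on the law of `X` that feed Hoeffding's
inequality are not available. -/
lemma measureReal_count_eq_zero {A : Set Ω} (hA : ∀ᵐ x ∂ν, x ∉ A) {k : ℕ} {b : ℝ} (hb : 0 < b) :
    (Measure.pi fun _ : Fin k => ν).real {ω | b ≤ count A ω} = 0 := by
  rw [measureReal_def, measure_eq_zero_iff_ae_notMem.2, ENNReal.toReal_zero]
  filter_upwards [ae_forall_pi hA k] with ω hω hmem
  have h0 : (count A ω : ℝ) = 0 := by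
    rw [count_eq_sum]
    exact Finset.sum_eq_zero fun i _ => indicator_of_notMem (hω i) _
  change b ≤ (count A ω : ℝ) at hmem
  linarith

/-- Concentration of the empirical quantile around the certainty-equivalent quantile. -/
lemma measureReal_atypical_le (hc : IsQuantileCoupling ν θ X G) {k b : ℕ} (hb : b + 1 ≤ k)
    {s : ℝ} (hs : 0 ≤ s) :
    (Measure.pi fun _ : Fin k => ν).real
      (atypical X k b (1 - ((b + 1 : ℕ) : ℝ) / ((k + 1 : ℕ) : ℝ) - s)
        (1 - ((b + 1 : ℕ) : ℝ) / ((k + 1 : ℕ) : ℝ) + s)) ≤ 2 * Real.exp (-(2 * k * s ^ 2)) := by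
  have hk : (0 : ℝ) < k := by exact_mod_cast (by omega : 0 < k)
  have hbk : ((b : ℝ) + 1) ≤ k := by exact_mod_cast hb
  have hexp : Real.exp (-(2 * (k * s) ^ 2 / k)) = Real.exp (-(2 * k * s ^ 2)) := by
    congr 2; field_simp
  have hks : 0 ≤ k * s := by positivity
  refine (measureReal_union_le _ _).trans ?_
  rw [two_mul, ← hexp]
  push_cast
  set d : ℝ := ((b : ℝ) + 1) / (k + 1) with hd
  have hd' : d * (k + 1) = b + 1 := by rw [hd]; field_simp
  have hd0 : 0 ≤ d := by positivity
  -- The certainty equivalent counts the current candidate (`b + 1` units for `k + 1` candidates),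
  -- whereas only `k` are sampled. The shift is harmless: `d (k+1) = b + 1` and `0 ≤ d ≤ 1` give `b
  -- ≤ k d ≤ b + 1`, which is what each tail needs for a deviation `k s`.
  refine add_le_add ?_ ?_
  · rcases le_or_gt (1 - d + s) 1 with hv | hv
    · refine measureReal_le_count_le (hc.measurable_sample measurableSet_Ici) hks ?_
      have := hc.measureReal_ge hv
      nlinarith
    · rw [measureReal_count_eq_zero _ (by positivity)]
      · positivity
      · filter_upwards [hc.ae_sample_mem] with x hx hmem
        exact absurd (hmem : 1 - d + s ≤ X x) (not_le.2 (hx.2.trans_lt hv))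
  · rcases le_or_gt 0 (1 - d - s) with hv | hv
    · refine measureReal_le_count_le (hc.measurable_sample measurableSet_Iic) hks ?_
      have := hc.measureReal_le hv
      nlinarith
    · rw [measureReal_count_eq_zero _ (by linarith)]
      · positivity
      · filter_upwards [hc.ae_sample_mem] with x hx hmem
        exact absurd (hmem : X x ≤ 1 - d - s) (not_le.2 (hv.trans hx.1))

/-- At most `b` samples reach `v`, so at least `k - b` lie below it, and an optimal set of size `b +
1` must contain one of these. -/
lemma exists_marginal_le {k b : ℕ} (hb : b + 1 ≤ k) {u v : ℝ} {ω : Fin k → Ω}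
    (h0 : ∀ i, 0 ≤ θ (ω i)) (hω : ω ∉ atypical X k b u v) :
    ∃ i, X (ω i) < v ∧
      offlineValue (b + 1) (fun i => θ (ω i)) ≤ offlineValue b (fun i => θ (ω i)) + θ (ω i) := by
  classical
  have h1 : ¬ ((b + 1 : ℕ) : ℝ) ≤ count (X ⁻¹' Ici v) ω := fun h => hω (Or.inl h)
  rw [Nat.cast_le, not_le] at h1
  have hsplit := Finset.card_filter_add_card_filter_not (s := (Finset.univ : Finset (Fin k)))
    (fun i => ω i ∈ X ⁻¹' Ici v)
  rw [Finset.card_univ, Fintype.card_fin] at hsplit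
  have hcount : count (X ⁻¹' Ici v) ω
      = (Finset.univ.filter fun i => ω i ∈ X ⁻¹' Ici v).card := by
    unfold count; congr
  rw [hcount] at h1
  obtain ⟨i, hi, hle⟩ := exists_offlineValue_succ_le (b := b) (θ := fun i => θ (ω i)) h0
    (A := Finset.univ.filter fun i => ¬ ω i ∈ X ⁻¹' Ici v) (by omega)
    (Finset.card_pos.1 (by omega))
  exact ⟨i, not_le.1 (Finset.mem_filter.1 hi).2, hle⟩

/-- More than `b` samples exceed `u`, so an optimal set for budget `b` omits one of them, which the
extra unit can buy. -/
lemma exists_le_marginal {k b : ℕ} {u v : ℝ} {ω : Fin k → Ω}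
    (hω : ω ∉ atypical X k b u v) :
    ∃ i, u < X (ω i) ∧
      offlineValue b (fun i => θ (ω i)) + θ (ω i) ≤ offlineValue (b + 1) (fun i => θ (ω i)) := by
  classical
  have h1 : ¬ ((k : ℝ) - b) ≤ count (X ⁻¹' Iic u) ω := fun h => hω (Or.inr h)
  have h2 : count (X ⁻¹' Iic u) ω + b < k := by
    have : (count (X ⁻¹' Iic u) ω : ℝ) + b < k := by linarith [not_le.1 h1]
    exact_mod_cast this
  have hsplit := Finset.card_filter_add_card_filter_not (s := (Finset.univ : Finset (Fin k)))
    (fun i => ω i ∈ X ⁻¹' Iic u)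
  rw [Finset.card_univ, Fintype.card_fin] at hsplit
  have hcount : count (X ⁻¹' Iic u) ω
      = (Finset.univ.filter fun i => ω i ∈ X ⁻¹' Iic u).card := by
    unfold count; congr
  rw [hcount] at h2
  obtain ⟨i, hi, hle⟩ := exists_le_offlineValue_succ (b := b) (fun i => θ (ω i))
    (A := Finset.univ.filter fun i => ¬ ω i ∈ X ⁻¹' Iic u) (by omega)
  exact ⟨i, not_le.1 (Finset.mem_filter.1 hi).2, hle⟩

/-- The loss of one decision with threshold `p` in expectation: at most `h` if the candidate's
quantile is close to the certainty equivalent and the future is typical. -/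
lemma integral_valueGap_succ_le (hc : IsQuantileCoupling ν θ X G) {k b : ℕ} (hk : m₀ ≤ k)
    (hb : b + 1 ≤ k) {ce r s h : ℝ} (hce : ce = 1 - ((b + 1 : ℕ) : ℝ) / ((k + 1 : ℕ) : ℝ))
    (hs : 0 ≤ s) (hsr : s ≤ r) (hh : 0 ≤ h) (hpr : |p (k + 1) (b + 1) - ce| ≤ r)
    (hU : ∀ᵐ x ∂ν, ∀ y ∈ Ioc (0 : ℝ) 1, p (k + 1) (b + 1) ≤ X x → X x < y → y < ce + s →
      G y ≤ G (X x) + h)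
    (hL : ∀ᵐ x ∂ν, ∀ y ∈ Ioc (0 : ℝ) 1, X x < p (k + 1) (b + 1) → y < X x → ce - s < y →
      G (X x) ≤ G y + h) :
    ∫ ω, valueGap θ X m₀ p (k + 1) (b + 1) ω ∂(Measure.pi fun _ : Fin (k + 1) => ν)
      ≤ max (∫ ω, valueGap θ X m₀ p k b ω ∂(Measure.pi fun _ : Fin k => ν))
          (∫ ω, valueGap θ X m₀ p k (b + 1) ω ∂(Measure.pi fun _ : Fin k => ν))
        + (2 * r * h + 2 * Real.exp (-(2 * k * s ^ 2))) := by
  set P : ℝ := p (k + 1) (b + 1) with hP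
  set π := Measure.pi fun _ : Fin k => ν with hπ
  set H : Set Ω := X ⁻¹' Ici P with hH
  set N : Set Ω := X ⁻¹' Icc (ce - r) (ce + r) with hN
  set Z : Set (Fin k → Ω) := atypical X k b (ce - s) (ce + s) with hZ
  have hHm : MeasurableSet H := hc.measurable_sample measurableSet_Ici
  have hNm : MeasurableSet N := hc.measurable_sample measurableSet_Icc
  have hZm : MeasurableSet Z := hc.measurableSet_atypical k b _ _
  have hZle : π.real Z ≤ 2 * Real.exp (-(2 * k * s ^ 2)) := by
    rw [hZ, hce]; exact hc.measureReal_atypical_le hb hs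
  have hNle : ν.real N ≤ 2 * r := (hc.measureReal_Icc_le (by linarith)).trans (by linarith)
  rw [abs_le] at hpr
  set f₀ := valueGap θ X m₀ p k b
  set f₁ := valueGap θ X m₀ p k (b + 1)
  set one : Set Ω → Ω → ℝ := fun A => A.indicator fun _ => (1 : ℝ) with hone
  set oneZ : (Fin k → Ω) → ℝ := Z.indicator fun _ => (1 : ℝ) with honeZ
  -- Every summand is a constant, a function of the current candidate, a function of the later ones,
  -- or a product of the last two, so independence turns the integral into products. The indicator
  -- of `Z` charges a loss of at most one to an atypical future.
  have hpt : ∀ᵐ z ∂(ν.prod π), valueGap θ X m₀ p (k + 1) (b + 1) (Fin.cons z.1 z.2)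
      ≤ (one H z.1 * f₀ z.2 + one Hᶜ z.1 * f₁ z.2) + (h * one N z.1 + oneZ z.2) := by
    filter_upwards [Measure.quasiMeasurePreserving_fst.ae hc.ae_ability_mem,
      Measure.quasiMeasurePreserving_fst.ae hc.ae_sample_mem,
      Measure.quasiMeasurePreserving_fst.ae hc.ability_eq,
      Measure.quasiMeasurePreserving_fst.ae hU, Measure.quasiMeasurePreserving_fst.ae hL,
      Measure.quasiMeasurePreserving_snd.ae (ae_forall_pi hc.ae_ability_mem k),
      Measure.quasiMeasurePreserving_snd.ae (ae_forall_pi hc.ae_sample_mem k),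
      Measure.quasiMeasurePreserving_snd.ae (ae_forall_pi hc.ability_eq k)]
      with z a1 a2 a3 hU hL b1 b2 b3
    have hoff := offlineValue_cons_le b (θ z.1) (fun i => θ (z.2 i))
    have hNn : 0 ≤ h * one N z.1 := mul_nonneg hh (indicator_one_mem_Icc _ _).1
    have hZn : 0 ≤ oneZ z.2 := (indicator_one_mem_Icc _ _).1
    have hmono := offlineValue_mono (Nat.le_succ b) (fun i => θ (z.2 i))
    simp only [valueGap]
    rw [cons_comp, twoPhaseValue, if_neg (by omega)]
    simp only [Fin.cons_zero, Fin.tail_cons, Nat.add_sub_cancel]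
    by_cases hx : P ≤ X z.1
    · rw [if_pos ⟨hx, Nat.succ_pos b⟩]
      have e1 : one H z.1 = 1 := indicator_of_mem (show z.1 ∈ H from hx) _
      have e2 : one Hᶜ z.1 = 0 := indicator_of_notMem (notMem_compl_iff.2 (show z.1 ∈ H from hx)) _
      rw [e1, e2, zero_mul, add_zero, one_mul]
      have hloss : offlineValue (b + 1) (fun i => θ (z.2 i))
          ≤ offlineValue b (fun i => θ (z.2 i)) + θ z.1 + (h * one N z.1 + oneZ z.2) := by
        by_cases hz : z.2 ∈ Z
        · have : oneZ z.2 = 1 := indicator_of_mem hz _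
          have := offlineValue_succ_le_add_one (b := b) (fun i => (b1 i).1) (fun i => (b1 i).2)
          linarith [a1.1]
        · obtain ⟨i, hi, hle⟩ := exists_marginal_le hb (fun i => (b1 i).1) hz
          rw [b3 i] at hle
          rw [a3]
          rcases le_or_gt (X (z.2 i)) (X z.1) with hxy | hxy
          · linarith [hc.mono _ _ hxy a2.2]
          -- Here `ce - r ≤ P ≤ X z.1 < X (z.2 i) < ce + s ≤ ce + r`: the candidate falls in the
          -- window, and `hU` bounds the loss by `h`.
          · have e3 : one N z.1 = 1 := indicator_of_mem
              (show z.1 ∈ N from ⟨by linarith, by linarith⟩) _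
            have := hU _ (b2 i) hx hxy hi
            rw [e3]; linarith
      simp only [f₀, valueGap]
      rcases le_max_iff.1 hoff with h' | h' <;> linarith
    · rw [if_neg (fun h => hx h.1)]
      have e1 : one H z.1 = 0 := indicator_of_notMem (show z.1 ∉ H from hx) _
      have e2 : one Hᶜ z.1 = 1 := indicator_of_mem (show z.1 ∈ Hᶜ from hx) _
      rw [e1, e2, zero_mul, zero_add, one_mul]
      have hloss : offlineValue b (fun i => θ (z.2 i)) + θ z.1
          ≤ offlineValue (b + 1) (fun i => θ (z.2 i)) + (h * one N z.1 + oneZ z.2) := by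
        by_cases hz : z.2 ∈ Z
        · have : oneZ z.2 = 1 := indicator_of_mem hz _
          linarith [a1.2]
        · obtain ⟨i, hi, hle⟩ := exists_le_marginal (θ := θ) hz
          rw [b3 i] at hle
          rw [a3]
          rcases le_or_gt (X z.1) (X (z.2 i)) with hxy | hxy
          · linarith [hc.mono _ _ hxy (b2 i).2]
          · push Not at hx
            have e3 : one N z.1 = 1 := indicator_of_mem
              (show z.1 ∈ N from ⟨by linarith, by linarith⟩) _
            have := hL _ (b2 i) hx hxy hi
            rw [e3]; linarith
      simp only [f₁, valueGap]
      rcases le_max_iff.1 hoff with h' | h' <;> linarith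
  have hint : ∀ A : Set Ω, MeasurableSet A → Integrable (one A) ν := fun A hA =>
    (memLp_indicator_one hA).integrable (by norm_num)
  have i1 : Integrable (fun z : Ω × (Fin k → Ω) => one H z.1 * f₀ z.2) (ν.prod π) :=
    (hint H hHm).mul_prod (hc.integrable_valueGap k b)
  have i2 : Integrable (fun z : Ω × (Fin k → Ω) => one Hᶜ z.1 * f₁ z.2) (ν.prod π) :=
    (hint Hᶜ hHm.compl).mul_prod (hc.integrable_valueGap k (b + 1))
  have i3 : Integrable (fun z : Ω × (Fin k → Ω) => h * one N z.1) (ν.prod π) :=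
    ((hint N hNm).const_mul h).comp_fst π
  have i4 : Integrable (fun z : Ω × (Fin k → Ω) => oneZ z.2) (ν.prod π) :=
    ((memLp_indicator_one hZm).integrable (by norm_num) : Integrable oneZ π).comp_snd ν
  have i12 : Integrable (fun z : Ω × (Fin k → Ω) => one H z.1 * f₀ z.2 + one Hᶜ z.1 * f₁ z.2)
      (ν.prod π) := i1.add i2
  have i34 : Integrable (fun z : Ω × (Fin k → Ω) => h * one N z.1 + oneZ z.2) (ν.prod π) :=
    i3.add i4
  have hval : ∫ z, ((one H z.1 * f₀ z.2 + one Hᶜ z.1 * f₁ z.2) + (h * one N z.1 + oneZ z.2))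
        ∂(ν.prod π)
      = (ν.real H * ∫ ω, f₀ ω ∂π) + ((1 - ν.real H) * ∫ ω, f₁ ω ∂π)
        + (h * ν.real N + π.real Z) := by
    rw [integral_add i12 i34, integral_add i1 i2, integral_add i3 i4,
      integral_prod_mul, integral_prod_mul, integral_fun_fst (fun x => h * one N x),
      integral_fun_snd oneZ, integral_const_mul]
    simp only [hone, honeZ]
    rw [integral_indicator_eq_measureReal hHm, integral_indicator_eq_measureReal hHm.compl,
      integral_indicator_eq_measureReal hNm, integral_indicator_eq_measureReal hZm,
      probReal_compl_eq_one_sub hHm]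
    simp
  rw [integral_cons k (hc.measurable_valueGap _ _)]
  refine (integral_mono_ae
    ((measurePreserving_cons k).integrable_comp_of_integrable (hc.integrable_valueGap _ _))
    (i12.add i34) hpt).trans ?_
  refine hval.le.trans (add_le_add ?_ ?_)
  -- The two continuations are weighted by the probabilities of hiring and rejecting; a convex
  -- combination is at most the maximum.
  · have h0 : 0 ≤ ν.real H := measureReal_nonneg
    have h1 : ν.real H ≤ 1 := measureReal_le_one
    set M := max (∫ ω, f₀ ω ∂π) (∫ ω, f₁ ω ∂π)
    have hM0 : ∫ ω, f₀ ω ∂π ≤ M := le_max_left _ _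
    have hM1 : ∫ ω, f₁ ω ∂π ≤ M := le_max_right _ _
    nlinarith
  · nlinarith

/-- Summation of the one-step losses over the first phase. -/
lemma integral_valueGap_le_sum (hc : IsQuantileCoupling ν θ X G) (loss : ℕ → ℝ) (j : ℕ)
    (hloss : ∀ i, 0 ≤ loss i)
    (hstep : ∀ k, m₀ ≤ k → k < m₀ + j → p (k + 1) (k + 1) ≤ 0 ∧ ∀ b, b + 1 ≤ k →
      ∫ ω, valueGap θ X m₀ p (k + 1) (b + 1) ω ∂(Measure.pi fun _ : Fin (k + 1) => ν)
      ≤ max (∫ ω, valueGap θ X m₀ p k b ω ∂(Measure.pi fun _ : Fin k => ν))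
          (∫ ω, valueGap θ X m₀ p k (b + 1) ω ∂(Measure.pi fun _ : Fin k => ν)) + loss k)
    {b : ℕ} (hb : b ≤ m₀ + j) :
    ∫ ω, valueGap θ X m₀ p (m₀ + j) b ω ∂(Measure.pi fun _ : Fin (m₀ + j) => ν)
      ≤ Real.sqrt m₀ + ∑ i ∈ Finset.range j, loss (m₀ + i) := by
  induction j generalizing b with
  | zero => simpa using hc.integral_valueGap_le_of_static hb
  | succ j ih =>
    have ih' := fun {b} => ih (b := b) fun k h1 h2 => hstep k h1 (by omega)
    obtain ⟨hfull, hinner⟩ := hstep (m₀ + j) (by omega) (by omega)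
    rw [Finset.sum_range_succ, ← add_assoc (Real.sqrt _)]
    have hpos : 0 ≤ Real.sqrt m₀ + ∑ i ∈ Finset.range j, loss (m₀ + i) :=
      add_nonneg (Real.sqrt_nonneg _) (Finset.sum_nonneg fun i _ => hloss _)
    rcases Nat.eq_zero_or_pos b with rfl | hb0
    · rw [integral_valueGap_zero_budget]
      exact add_nonneg hpos (hloss _)
    rcases hb.eq_or_lt with rfl | hlt
    · refine (hc.integral_valueGap_full_le (by omega) hfull).trans ?_
      exact (ih' le_rfl).trans (le_add_of_nonneg_right (hloss _))
    · obtain ⟨c, rfl⟩ : ∃ c, b = c + 1 := ⟨b - 1, by omega⟩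
      refine (hinner c (by omega)).trans (add_le_add (max_le ?_ ?_) le_rfl)
      · exact ih' (by omega)
      · exact ih' (by omega)

end IsQuantileCoupling

end Step

/-! ### Sums of powers -/

section Sums

/-- Bernoulli's inequality for exponents in `(0,1]`, at `1 - 1/(k+1)`. The right-hand side
telescopes. -/
lemma rpow_sub_one_le_sub {c : ℝ} (hc : 0 < c) (hc1 : c ≤ 1) (k : ℕ) :
    ((k : ℝ) + 1) ^ (c - 1) ≤ (((k : ℝ) + 1) ^ c - (k : ℝ) ^ c) / c := by
  have hx : (0 : ℝ) < (k : ℝ) + 1 := by positivity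
  rw [le_div_iff₀ hc, Real.rpow_sub_one hx.ne']
  have hk : (k : ℝ) ^ c = ((k : ℝ) + 1) ^ c * (1 + -(1 / ((k : ℝ) + 1))) ^ c := by
    have h1 : 0 ≤ 1 + -(1 / ((k : ℝ) + 1)) := by
      have : 1 / ((k : ℝ) + 1) ≤ 1 := by
        rw [div_le_one hx]; linarith [Nat.cast_nonneg (α := ℝ) k]
      linarith
    rw [← Real.mul_rpow hx.le h1]
    congr 1; field_simp; ring
  have hb : (1 + -(1 / ((k : ℝ) + 1))) ^ c ≤ 1 + c * -(1 / ((k : ℝ) + 1)) := by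
    refine rpow_one_add_le_one_add_mul_self ?_ hc.le hc1
    rw [neg_le_neg_iff, div_le_one hx]; linarith [Nat.cast_nonneg (α := ℝ) k]
  have hp : 0 ≤ ((k : ℝ) + 1) ^ c := by positivity
  rw [hk]
  have := mul_le_mul_of_nonneg_left hb hp
  have e : ((k : ℝ) + 1) ^ c * (1 + c * -(1 / ((k : ℝ) + 1)))
      = ((k : ℝ) + 1) ^ c - ((k : ℝ) + 1) ^ c / ((k : ℝ) + 1) * c := by field_simp; ring
  linarith

lemma sum_rpow_sub_one_le {c : ℝ} (hc : 0 < c) (hc1 : c ≤ 1) (T : ℕ) :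
    ∑ k ∈ Finset.range T, ((k : ℝ) + 1) ^ (c - 1) ≤ (T : ℝ) ^ c / c := by
  induction T with
  | zero => simp [Real.zero_rpow hc.ne']
  | succ T ih =>
    rw [Finset.sum_range_succ]
    have := rpow_sub_one_le_sub hc hc1 T
    rw [sub_div] at this
    push_cast
    linarith

/-- Starting at `1/2` and not at `1` leaves a pure logarithm with no additive constant, so the bound
still holds when `log T = 0`. -/
lemma sum_one_div_le_log (T : ℕ) :
    ∑ k ∈ Finset.range T, 1 / ((k : ℝ) + 2) ≤ Real.log ((T : ℝ) + 1) := by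
  induction T with
  | zero => simp
  | succ T ih =>
    rw [Finset.sum_range_succ]
    have h1 : (0 : ℝ) < (T : ℝ) + 1 := by positivity
    have h2 : (0 : ℝ) < (T : ℝ) + 2 := by positivity
    have h := Real.log_le_sub_one_of_pos (div_pos h1 h2)
    rw [Real.log_div h1.ne' h2.ne'] at h
    have e : ((T : ℝ) + 1) / (T + 2) - 1 = -(1 / ((T : ℝ) + 2)) := by field_simp; ring
    rw [e] at h
    push_cast
    rw [show (T : ℝ) + 1 + 1 = T + 2 by ring]
    linarith

/-- A bound for the loss of the decision that leaves `k` candidates, with `l = log T`. -/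
def lossBound (a δ l : ℝ) (k : ℕ) : ℝ :=
  if k = 0 then 0 else
    (8 * l / (k + 1)) ^ a + δ * Real.sqrt (8 * l / (k + 1)) + 4 * (1 / (k + 1))

lemma lossBound_nonneg {a δ l : ℝ} (hδ : 0 ≤ δ) (hl : 0 ≤ l) (k : ℕ) :
    0 ≤ lossBound a δ l k := by
  unfold lossBound
  split_ifs
  · exact le_rfl
  · positivity

lemma rpow_exponent {β : ℝ} (hβ : 0 ≤ β) :
    (1 / 2 + 1 / (2 * (β + 1)) ≤ 1) ∧ 0 < 1 / 2 + 1 / (2 * (β + 1)) := by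
  constructor
  · have : 1 / (2 * (β + 1)) ≤ 1 / 2 := by
      apply one_div_le_one_div_of_le <;> linarith
    linarith
  · positivity

lemma sum_lossBound_le {β δ : ℝ} (hβ : 0 ≤ β) (hδ : 0 ≤ δ) {T : ℕ} (hT : 1 ≤ T) :
    ∑ k ∈ Finset.range T, lossBound (1 / 2 + 1 / (2 * (β + 1))) δ (Real.log T) k ≤
      (if 0 < β then
        16 * (1 + 1 / β) * Real.log T ^ (1 / 2 + 1 / (2 * (β + 1)))
          * (T : ℝ) ^ (1 / 2 - 1 / (2 * (1 + β)))
      else 0) + 16 * Real.log T ^ 2 + 16 * δ * Real.sqrt (T * Real.log T) := by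
  obtain ⟨N, rfl⟩ : ∃ N, T = N + 1 := ⟨T - 1, by omega⟩
  obtain ⟨ha1, ha0⟩ := rpow_exponent hβ
  set a : ℝ := 1 / 2 + 1 / (2 * (β + 1)) with ha
  set l := Real.log ((N + 1 : ℕ) : ℝ) with hl
  have hl0 : 0 ≤ l := Real.log_nonneg (by exact_mod_cast hT)
  have hinv : ∑ k ∈ Finset.range N, 1 / ((k : ℝ) + 2) ≤ l := by
    rw [hl]; push_cast; exact sum_one_div_le_log N
  -- Either `T = 1` and `l = 0`, or `l ≥ log 2 > 1/2`. This absorbs the harmonic sum of the atypical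
  -- events into `log² T`.
  have hl2 : l ≤ 2 * l ^ 2 := by
    rcases Nat.eq_zero_or_pos N with rfl | hN
    · simp [hl]
    · have : Real.log 2 ≤ l := Real.log_le_log (by norm_num) (by push_cast; norm_cast; omega)
      have := Real.log_two_gt_d9
      nlinarith
  -- The term `k = 0` is zero by definition: with one candidate left the budget is empty or full,
  -- and neither case causes a loss. Hence the denominators start at `2`.
  have hsplit : ∑ k ∈ Finset.range (N + 1), lossBound a δ l k
      = (∑ k ∈ Finset.range N, (8 * l / ((k : ℝ) + 2)) ^ a)
        + (∑ k ∈ Finset.range N, δ * Real.sqrt (8 * l / ((k : ℝ) + 2)))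
        + ∑ k ∈ Finset.range N, 4 * (1 / ((k : ℝ) + 2)) := by
    rw [Finset.sum_range_succ', ← Finset.sum_add_distrib, ← Finset.sum_add_distrib]
    simp only [lossBound, if_true, add_zero]
    refine Finset.sum_congr rfl fun k _ => ?_
    rw [if_neg (Nat.succ_ne_zero k)]
    push_cast
    rw [show (k : ℝ) + 1 + 1 = k + 2 by ring]
  have hshift : ∀ f : ℝ → ℝ, (∀ x, 0 < x → 0 ≤ f x) →
      ∑ k ∈ Finset.range N, f ((k : ℝ) + 2) ≤ ∑ k ∈ Finset.range (N + 1), f ((k : ℝ) + 1) := by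
    intro f hf
    rw [Finset.sum_range_succ']
    refine le_add_of_le_of_nonneg (le_of_eq (Finset.sum_congr rfl fun k _ => ?_)) (hf _ (by simp))
    push_cast
    rw [show (k : ℝ) + 1 + 1 = k + 2 by ring]
  have hsqrt : ∑ k ∈ Finset.range N, δ * Real.sqrt (8 * l / ((k : ℝ) + 2))
      ≤ 16 * δ * Real.sqrt ((N + 1 : ℕ) * l) := by
    have h1 := hshift (fun x => δ * Real.sqrt (8 * l / x)) fun x _ => by positivity
    refine h1.trans ?_
    have h2 := sum_rpow_sub_one_le (c := 1 / 2) (by norm_num) (by norm_num) (N + 1)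
    have h3 : ∀ k : ℕ, δ * Real.sqrt (8 * l / ((k : ℝ) + 1))
        = δ * Real.sqrt (8 * l) * ((k : ℝ) + 1) ^ ((1 / 2 : ℝ) - 1) := by
      intro k
      have hk : (0 : ℝ) ≤ (k : ℝ) + 1 := by positivity
      rw [Real.sqrt_div (by positivity), show (1 / 2 : ℝ) - 1 = -(1 / 2) by norm_num,
        Real.rpow_neg hk, ← Real.sqrt_eq_rpow, mul_assoc, div_eq_mul_inv]
    simp_rw [h3]
    rw [← Finset.mul_sum]
    refine (mul_le_mul_of_nonneg_left h2 (by positivity)).trans ?_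
    rw [← Real.sqrt_eq_rpow, Real.sqrt_mul (by positivity) l, Real.sqrt_mul (by positivity) l]
    have h8 : Real.sqrt 8 ≤ 8 := by
      rw [Real.sqrt_le_left (by norm_num)]; norm_num
    have hA : 0 ≤ δ * Real.sqrt l * Real.sqrt ((N + 1 : ℕ) : ℝ) := by positivity
    have := mul_le_mul_of_nonneg_right h8 hA
    linarith
  have hlast : ∑ k ∈ Finset.range N, 4 * (1 / ((k : ℝ) + 2)) ≤ 8 * l ^ 2 := by
    rw [← Finset.mul_sum]; linarith
  rw [hsplit]
  split_ifs with hβ0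
  · have hmain : ∑ k ∈ Finset.range N, (8 * l / ((k : ℝ) + 2)) ^ a
        ≤ 16 * (1 + 1 / β) * l ^ a * ((N + 1 : ℕ) : ℝ) ^ (1 / 2 - 1 / (2 * (1 + β))) := by
      have hc : 1 / 2 - 1 / (2 * (1 + β)) = 1 - a := by rw [ha]; field_simp; ring
      -- The power sum is divided by its exponent `1 - a`; this is the origin of the factor `1 +
      -- 1/β`. For `β = 0` the exponent vanishes and a harmonic sum takes its place.
      have hc' : 1 - a = β / (2 * (β + 1)) := by rw [ha]; field_simp; ring
      have hc0 : 0 < 1 - a := by rw [hc']; positivity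
      rw [hc]
      have h1 := hshift (fun x => (8 * l / x) ^ a) fun x _ => by positivity
      refine h1.trans ?_
      have h2 := sum_rpow_sub_one_le (c := 1 - a) hc0 (by linarith) (N + 1)
      have h3 : ∀ k : ℕ, (8 * l / ((k : ℝ) + 1)) ^ a
          = (8 * l) ^ a * ((k : ℝ) + 1) ^ ((1 - a) - 1) := by
        intro k
        have hk : (0 : ℝ) ≤ (k : ℝ) + 1 := by positivity
        rw [Real.div_rpow (by positivity) hk, show (1 - a) - 1 = -a by ring, Real.rpow_neg hk,
          div_eq_mul_inv]
      simp_rw [h3]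
      rw [← Finset.mul_sum]
      refine (mul_le_mul_of_nonneg_left h2 (by positivity)).trans ?_
      have h8 : (8 : ℝ) ^ a ≤ 8 := by
        calc (8 : ℝ) ^ a ≤ 8 ^ (1 : ℝ) := Real.rpow_le_rpow_of_exponent_le (by norm_num) ha1
          _ = 8 := Real.rpow_one 8
      have hinv' : 1 / (1 - a) = 2 * (1 + 1 / β) := by rw [hc']; field_simp
      rw [Real.mul_rpow (by norm_num) hl0, div_eq_mul_one_div _ (1 - a), hinv']
      have hA : 0 ≤ l ^ a * (((N + 1 : ℕ) : ℝ) ^ (1 - a) * (2 * (1 + 1 / β))) := by positivity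
      have := mul_le_mul_of_nonneg_right h8 hA
      linarith
    have : 0 ≤ l ^ 2 := sq_nonneg l
    linarith
  · have hβ' : β = 0 := le_antisymm (not_lt.1 hβ0) hβ
    have ha' : a = 1 := by rw [ha, hβ']; norm_num
    have hmain : ∑ k ∈ Finset.range N, (8 * l / ((k : ℝ) + 2)) ^ a ≤ 8 * l ^ 2 := by
      rw [ha']
      simp_rw [Real.rpow_one, div_eq_mul_one_div (8 * l)]
      rw [← Finset.mul_sum]
      nlinarith
    linarith

end Sums

/-! ### Gaps and thresholds -/

section Gaps

variable {μ : Measure ℝ} {β ε₀ δ : ℝ} {n : ℕ} {q : Fin (n + 2) → ℝ}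

namespace IsClusteredWith

lemma exists_cell (hq : IsClusteredWith μ β ε₀ δ q) {y : ℝ} (hy : y ∈ Ioc (0 : ℝ) 1) :
    ∃ i : Fin (n + 1), y ∈ Ioc (q i.castSucc) (q i.succ) := by
  classical
  have hne : (Finset.univ.filter fun j => y ≤ q j).Nonempty :=
    ⟨Fin.last (n + 1), by simp [hq.last, hy.2]⟩
  set j := (Finset.univ.filter fun j => y ≤ q j).min' hne with hj
  have hjmem : y ≤ q j := (Finset.mem_filter.1 (Finset.min'_mem _ hne)).2
  have hj0 : j ≠ 0 := by
    intro h
    rw [h, hq.first] at hjmem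
    linarith [hy.1]
  obtain ⟨i, hi⟩ := Fin.exists_succ_eq.2 hj0
  refine ⟨i, ?_, hi ▸ hjmem⟩
  by_contra! hle
  have : j ≤ i.castSucc := Finset.min'_le _ _ (by simp [hle])
  rw [← hi] at this
  exact absurd this (not_le.2 (Fin.castSucc_lt_succ))

/-- The quantile function varies slowly between two quantiles that no gap separates. -/
lemma quantile_sub_le (hq : IsClusteredWith μ β ε₀ δ q) {x y : ℝ} (hx : 0 < x)
    (hy : y ≤ 1) (hxy : x < y)
    (hgap : ∀ i : Fin n, x ≤ q i.castSucc.succ → y ≤ q i.castSucc.succ) :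
    quantile μ y - quantile μ x ≤ (y - x) ^ (1 / (β + 1)) + δ := by
  obtain ⟨i, hi⟩ := hq.exists_cell (y := y) ⟨hx.trans hxy, hy⟩
  -- If the cell of `y` did not contain `x`, its left end would be a gap in `[x, y)`, or the point
  -- `0` if it is the first cell.
  have hxi : q i.castSucc < x := by
    refine Fin.cases ?_ (fun j => ?_) i (motive := fun i => y ∈ Ioc (q i.castSucc) (q i.succ) →
      q i.castSucc < x) hi
    · intro _; rw [Fin.castSucc_zero, hq.first]; exact hx
    · intro hj
      by_contra! hle
      rw [← Fin.succ_castSucc] at hle hj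
      exact absurd (hgap j hle) (not_le.2 hj.1)
  have h := hq.density i y hi x ⟨hxi, hxy.le.trans hi.2⟩
  rw [abs_of_pos (sub_pos.2 hxy)] at h
  exact (le_abs_self _).trans h

lemma gap_add_le (hq : IsClusteredWith μ β ε₀ δ q) {i j : Fin n} (hij : i < j) :
    q i.castSucc.succ + ε₀ ≤ q j.castSucc.succ := by
  have h := hq.size i.succ
  have h2 : q i.succ.succ ≤ q j.castSucc.succ := by
    refine hq.strictMono.monotone ?_
    rw [Fin.le_def]; simp only [Fin.val_succ, Fin.val_castSucc]; exact Nat.succ_le_succ hij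
  rw [Fin.succ_castSucc]; linarith

lemma le_abs_gap_sub (hq : IsClusteredWith μ β ε₀ δ q) {i j : Fin n} (hij : i ≠ j) :
    ε₀ ≤ |q i.castSucc.succ - q j.castSucc.succ| := by
  rcases lt_or_gt_of_ne hij with h | h
  · have := hq.gap_add_le h
    exact (by linarith : ε₀ ≤ -(q i.castSucc.succ - q j.castSucc.succ)).trans (neg_le_abs _)
  · have := hq.gap_add_le h
    exact (by linarith : ε₀ ≤ q i.castSucc.succ - q j.castSucc.succ).trans (le_abs_self _)

lemma le_gap (hq : IsClusteredWith μ β ε₀ δ q) (i : Fin n) : ε₀ ≤ q i.castSucc.succ := by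
  have h := hq.size i.castSucc
  have h2 : q 0 ≤ q i.castSucc.castSucc := hq.strictMono.monotone (Fin.zero_le _)
  rw [hq.first] at h2; linarith

/-- An interior gap has a cell of length at least `ε₀` on either side within `[0,1]`. -/
lemma le_half (hq : IsClusteredWith μ β ε₀ δ q) (i : Fin n) : ε₀ ≤ 1 / 2 := by
  have h := hq.size i.succ
  have h2 : q i.succ.succ ≤ q (Fin.last (n + 1)) := hq.strictMono.monotone (Fin.le_last _)
  have h3 := hq.le_gap i
  rw [Fin.succ_castSucc] at h3
  rw [hq.last] at h2; linarith

end IsClusteredWith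

/-- The threshold `P` is the certainty equivalent `ce` if no gap is closer than `r`, and
otherwise a nearest gap. -/
def IsGapConservative (q : Fin (n + 2) → ℝ) (ce r P : ℝ) : Prop :=
  ((∀ i : Fin n, r ≤ |ce - q i.castSucc.succ|) ∧ P = ce) ∨
    ∃ j : Fin n, |ce - q j.castSucc.succ| < r ∧
      (∀ i : Fin n, |ce - q j.castSucc.succ| ≤ |ce - q i.castSucc.succ|) ∧ P = q j.castSucc.succ

namespace IsGapConservative

variable {ce r P : ℝ}

lemma abs_sub_le (h : IsGapConservative q ce r P) (hr : 0 ≤ r) : |P - ce| ≤ r := by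
  rcases h with ⟨-, rfl⟩ | ⟨j, hj, -, rfl⟩
  · simpa using hr
  · rw [abs_sub_comm]; exact hj.le

/-- No gap lies between a quantile above the threshold and a point slightly above the certainty
equivalent. -/
lemma no_gap_above (h : IsGapConservative q ce r P) (hq : IsClusteredWith μ β ε₀ δ q) {s : ℝ}
    (hsr : s ≤ r) (hs : ∀ _ : Fin n, 2 * s ≤ ε₀) {x y : ℝ}
    (hx : ∀ i : Fin n, x ≠ q i.castSucc.succ) (hPx : P ≤ x) (hy : y < ce + s) (i : Fin n)
    (hi : x ≤ q i.castSucc.succ) : y ≤ q i.castSucc.succ := by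
  by_contra! hlt
  -- If the threshold is `ce`, a separating gap would be within `s ≤ r` of it. If it is the nearest
  -- gap `j`, a separating gap `i` lies above `j` by at least `ε₀`; since `j` is at least as near to
  -- `ce`, gap `i` is at least `ε₀/2 ≥ s` above `ce`, hence not below `y`.
  rcases h with ⟨hfar, rfl⟩ | ⟨j, -, hmin, rfl⟩
  · have := hfar i
    rw [abs_sub_comm, abs_of_nonneg (by linarith)] at this
    linarith
  · have hij : i ≠ j := by
      rintro rfl
      exact hx i (le_antisymm hi hPx)
    have hne := hq.le_abs_gap_sub hij
    have hm := hmin i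
    have hji : q j.castSucc.succ < q i.castSucc.succ :=
      lt_of_le_of_lt hPx (lt_of_le_of_ne hi (hx i))
    rw [abs_of_pos (by linarith)] at hne
    have := hs i
    rcases le_total ce (q i.castSucc.succ) with hc | hc
    · rw [abs_sub_comm ce (q i.castSucc.succ), abs_of_nonneg (sub_nonneg.2 hc)] at hm
      have := (abs_le.1 hm).2
      linarith
    · rw [abs_of_nonneg (sub_nonneg.2 hc)] at hm
      have := (abs_le.1 hm).2
      linarith

/-- No gap lies between a quantile below the threshold and a point slightly below the certainty
equivalent. -/
lemma no_gap_below (h : IsGapConservative q ce r P) (hq : IsClusteredWith μ β ε₀ δ q) {s : ℝ}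
    (hsr : s ≤ r) (hs : ∀ _ : Fin n, 2 * s ≤ ε₀) {x y : ℝ}
    (hPx : x < P) (hy : ce - s < y) (i : Fin n)
    (hi : y ≤ q i.castSucc.succ) : x ≤ q i.castSucc.succ := by
  by_contra! hlt
  -- The mirror image, except that `x < P` is strict and already excludes `i = j`, so `x` may itself
  -- be a gap quantile.
  rcases h with ⟨hfar, rfl⟩ | ⟨j, -, hmin, rfl⟩
  · have := hfar i
    rw [abs_of_nonneg (by linarith)] at this
    linarith
  · have hij : j ≠ i := by
      rintro rfl
      linarith
    have hne := hq.le_abs_gap_sub hij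
    have hm := hmin i
    rw [abs_of_pos (by linarith)] at hne
    have := hs i
    rcases le_total ce (q i.castSucc.succ) with hc | hc
    · rw [abs_sub_comm ce (q i.castSucc.succ), abs_of_nonneg (sub_nonneg.2 hc)] at hm
      have := (abs_le.1 hm).1
      linarith
    · rw [abs_of_nonneg (sub_nonneg.2 hc)] at hm
      have := (abs_le.1 hm).1
      linarith

end IsGapConservative

/-- The radius within which CwG considers a gap to be close, with `m` candidates left. -/
def gapRadius (m : ℕ) : ℝ := Real.sqrt (2 * (Real.log m / m))

lemma gapRadius_nonneg (m : ℕ) : 0 ≤ gapRadius m := Real.sqrt_nonneg _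

lemma gapRadius_sq (m : ℕ) : gapRadius m ^ 2 = 2 * (Real.log m / m) :=
  Real.sq_sqrt (by have := Real.log_natCast_nonneg m; positivity)

/-- The claim is `2 log m < ε₀² m`. The inequality `log x ≤ x - 1` at `x = m ε₀²/4` yields `2 log m
≤ ε₀² m / 2 + 4 log (1/ε₀) + 4 log 2`, where `log 2 ≤ log (1/ε₀)` because `ε₀ ≤ 1/2`; the constant
`16` makes the logarithms smaller than the other half of `ε₀² m`. -/
lemma gapRadius_lt {m : ℕ} (hε : 0 < ε₀) (hε2 : ε₀ ≤ 1 / 2)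
    (hm : 16 * Real.log (1 / ε₀) / ε₀ ^ 2 < m) : gapRadius m < ε₀ := by
  have hL : Real.log 2 ≤ Real.log (1 / ε₀) := by
    refine Real.log_le_log (by norm_num) ?_
    rw [le_div_iff₀ hε]; linarith
  have hlog2 : 0 < Real.log 2 := Real.log_pos (by norm_num)
  have hm0 : (0 : ℝ) < m := 
    lt_of_le_of_lt (div_nonneg (mul_nonneg (by norm_num) (hlog2.le.trans hL)) (sq_nonneg _)) hm
  rw [div_lt_iff₀ (by positivity)] at hm
  have hK : 0 < ε₀ ^ 2 / 4 := by positivity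
  have h1 := Real.log_le_sub_one_of_pos (mul_pos hm0 hK)
  rw [Real.log_mul hm0.ne' hK.ne', Real.log_div (by positivity) (by norm_num),
    Real.log_pow, show (4 : ℝ) = 2 ^ 2 by norm_num, Real.log_pow] at h1
  rw [one_div, Real.log_inv] at hL hm
  push_cast at h1
  rw [gapRadius, Real.sqrt_lt' hε, mul_div_assoc', div_lt_iff₀ hm0]
  nlinarith

end Gaps

/-! ### The one-step loss of CwG -/

section Loss

variable {Ω : Type*} [MeasurableSpace Ω] {ν : Measure Ω} [IsProbabilityMeasure ν]
  {θ X : Ω → ℝ} {μ : Measure ℝ} {β ε₀ δ : ℝ} {n : ℕ} {q : Fin (n + 2) → ℝ}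

/-- The exponent equals `-log (k+1) + log (k+1) / (k+1)`, and the correction is at most `log 2`. -/
lemma exp_neg_mul_gapRadius_le {k : ℕ} :
    Real.exp (-(2 * k * (gapRadius (k + 1) / 2) ^ 2)) ≤ 2 * (1 / ((k : ℝ) + 1)) := by
  have hx : (0 : ℝ) < (k : ℝ) + 1 := by positivity
  have h2 : (k : ℝ) + 1 ≤ 2 ^ (k + 1) := by exact_mod_cast (Nat.lt_two_pow_self (n := k + 1)).le
  have h3 : Real.log ((k : ℝ) + 1) ≤ ((k : ℝ) + 1) * Real.log 2 := by
    have := Real.log_le_log hx h2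
    rwa [Real.log_pow, Nat.cast_add_one] at this
  have h4 : Real.log ((k : ℝ) + 1) / ((k : ℝ) + 1) ≤ Real.log 2 := by
    rw [div_le_iff₀ hx]; linarith
  have h5 : 2 * (1 / ((k : ℝ) + 1)) = Real.exp (Real.log 2 - Real.log ((k : ℝ) + 1)) := by
    rw [Real.exp_sub, Real.exp_log (by norm_num), Real.exp_log hx]; ring
  rw [h5, Real.exp_le_exp, div_pow, gapRadius_sq]
  have h6 : -(2 * k * (2 * (Real.log ((k + 1 : ℕ) : ℝ) / ((k + 1 : ℕ) : ℝ)) / 2 ^ 2))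
      = Real.log ((k : ℝ) + 1) / ((k : ℝ) + 1) - Real.log ((k : ℝ) + 1) := by
    push_cast; field_simp; ring
  rw [h6]; linarith

/-- Window length `2r` times variation of the quantile function, plus the atypical probability. The
exponent `1/2 + 1/(2(β+1))` arises by writing `(2r)^(1 + 1/(β+1))` as a power of `(2r)²`. -/
lemma loss_le_lossBound {T k : ℕ} (hβ : 0 ≤ β) (hδ : 0 ≤ δ) (hk : 1 ≤ k) (hkT : k + 1 ≤ T) :
    2 * gapRadius (k + 1) * ((2 * gapRadius (k + 1)) ^ (1 / (β + 1)) + δ)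
        + 2 * Real.exp (-(2 * k * (gapRadius (k + 1) / 2) ^ 2))
      ≤ lossBound (1 / 2 + 1 / (2 * (β + 1))) δ (Real.log T) k := by
  rw [lossBound, if_neg (by omega)]
  have hx : (0 : ℝ) < (k : ℝ) + 1 := by positivity
  set r := gapRadius (k + 1)
  have hr : 0 ≤ 2 * r := mul_nonneg zero_le_two (gapRadius_nonneg _)
  have hlog : Real.log ((k + 1 : ℕ) : ℝ) ≤ Real.log T :=
    Real.log_le_log (by positivity) (by exact_mod_cast hkT)
  have hsq : (2 * r) ^ 2 ≤ 8 * Real.log T / (k + 1) := by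
    rw [mul_pow, gapRadius_sq, mul_div_assoc]
    push_cast at hlog ⊢
    have : Real.log ((k : ℝ) + 1) / ((k : ℝ) + 1) ≤ Real.log T / ((k : ℝ) + 1) := by gcongr
    linarith
  have h1 : 2 * r ≤ Real.sqrt (8 * Real.log T / (k + 1)) := Real.le_sqrt_of_sq_le hsq
  have h2 : 2 * r * (2 * r) ^ (1 / (β + 1))
      ≤ (8 * Real.log T / (k + 1)) ^ (1 / 2 + 1 / (2 * (β + 1))) := by
    have e : 2 * r * (2 * r) ^ (1 / (β + 1))
        = ((2 * r) ^ 2) ^ (1 / 2 + 1 / (2 * (β + 1))) := by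
      have hexp : ((2 : ℕ) : ℝ) * (1 / 2 + 1 / (2 * (β + 1))) = 1 + 1 / (β + 1) := by
        push_cast; field_simp
      rw [← Real.rpow_natCast, ← Real.rpow_mul hr, hexp,
        Real.rpow_add_of_nonneg hr zero_le_one (by positivity), Real.rpow_one]
    rw [e]
    exact Real.rpow_le_rpow (sq_nonneg _) hsq (rpow_exponent hβ).2.le
  have h3 := exp_neg_mul_gapRadius_le (k := k)
  have h4 := mul_le_mul_of_nonneg_left h1 hδ
  linarith

/-- The one-step losses of CwG in the first phase. -/
lemma valueGap_step (hc : IsQuantileCoupling ν θ X (quantile μ))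
    (hq : IsClusteredWith μ β ε₀ δ q) (hβ : 0 ≤ β) (hδ : 0 ≤ δ) {m₀ : ℕ} {p : ℕ → ℕ → ℝ}
    {T k : ℕ} (hk : m₀ ≤ k) (hkT : k + 1 ≤ T)
    (hp : ∀ b : ℕ, IsGapConservative q (1 - (b : ℝ) / ((k + 1 : ℕ) : ℝ)) (gapRadius (k + 1))
      (p (k + 1) b))
    (hr : ∀ _ : Fin n, gapRadius (k + 1) < ε₀) :
    p (k + 1) (k + 1) ≤ 0 ∧ ∀ b, b + 1 ≤ k →
      ∫ ω, valueGap θ X m₀ p (k + 1) (b + 1) ω ∂(Measure.pi fun _ : Fin (k + 1) => ν)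
      ≤ max (∫ ω, valueGap θ X m₀ p k b ω ∂(Measure.pi fun _ : Fin k => ν))
          (∫ ω, valueGap θ X m₀ p k (b + 1) ω ∂(Measure.pi fun _ : Fin k => ν))
        + lossBound (1 / 2 + 1 / (2 * (β + 1))) δ (Real.log T) k := by
  constructor
  -- With full budget the certainty equivalent is `0`; every gap is at least `ε₀ > r` away, so the
  -- threshold cannot move up to a gap.
  · have hself : (1 : ℝ) - ((k + 1 : ℕ) : ℝ) / ((k + 1 : ℕ) : ℝ) = 0 := by
      rw [div_self (by positivity), sub_self]
    have h := hp (k + 1)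
    rw [hself] at h
    rcases h with ⟨-, h⟩ | ⟨j, hj, -, -⟩
    · exact h.le
    · have h1 := hq.le_gap j
      have h2 := hr j
      rw [zero_sub, abs_neg] at hj
      linarith [le_abs_self (q j.castSucc.succ)]
  · intro b hb
    set r := gapRadius (k + 1) with hrdef
    have hr0 : 0 ≤ r := gapRadius_nonneg _
    have hs : ∀ _ : Fin n, 2 * (r / 2) ≤ ε₀ := fun i => by linarith [hr i]
    have hsr : r / 2 ≤ r := by linarith
    have hP := hp (b + 1)
    have hPr := hP.abs_sub_le hr0
    have hPr' := abs_le.1 hPr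
    have hexp : 0 ≤ 1 / (β + 1) := by positivity
    -- Cells are open on the left, so a sample equal to a gap threshold would be hired although it
    -- belongs to the cell below.
    have hne : ∀ᵐ x ∂ν, ∀ i : Fin n, X x ≠ q i.castSucc.succ := by
      filter_upwards [hc.ae_sample_notMem (finite_range q).countable] with x hx i h
      exact hx ⟨_, h.symm⟩
    refine (hc.integral_valueGap_succ_le (h := (2 * r) ^ (1 / (β + 1)) + δ) hk hb rfl
      (by linarith) hsr (by positivity) hPr ?_ ?_).trans
      (add_le_add le_rfl (loss_le_lossBound hβ hδ (by omega) hkT))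
    · filter_upwards [hne, hc.ae_sample_mem] with x hx hx01 y hy hPx hxy hyc
      have hcell := hq.quantile_sub_le hx01.1 hy.2 hxy
        (hP.no_gap_above hq hsr hs hx hPx hyc)
      have hpow : (y - X x) ^ (1 / (β + 1)) ≤ (2 * r) ^ (1 / (β + 1)) :=
        Real.rpow_le_rpow (by linarith) (by linarith) hexp
      linarith
    · filter_upwards [hc.ae_sample_mem] with x hx01 y hy hPx hxy hyc
      have hcell := hq.quantile_sub_le hy.1 hx01.2 hxy
        (hP.no_gap_below hq hsr hs hPx hyc)
      have hpow : (X x - y) ^ (1 / (β + 1)) ≤ (2 * r) ^ (1 / (β + 1)) :=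
        Real.rpow_le_rpow (by linarith) (by linarith) hexp
      linarith

/-- Time is converted to the number `m` of candidates left. A nearest gap among the near ones is
nearest among all, since the others are at least the radius away. -/
lemma isGapConservative_of_isCwGThreshold {T : ℕ} {p : ℕ → ℕ → ℝ} (hp : IsCwGThreshold T q p)
    {m : ℕ} (hm : m ≤ T) (b : ℕ) :
    IsGapConservative q (1 - (b : ℝ) / (m : ℝ)) (gapRadius m) (p (T - m) b) := by
  have hcast : (T : ℝ) - ((T - m : ℕ) : ℝ) = m := by rw [Nat.cast_sub hm]; ring
  have hce : ceThreshold T (T - m) b = 1 - (b : ℝ) / (m : ℝ) := by rw [ceThreshold, hcast]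
  have hmem : ∀ i : Fin n, i ∈ nearGaps T q (T - m) b ↔
      |1 - (b : ℝ) / (m : ℝ) - q i.castSucc.succ| < gapRadius m := by
    intro i
    change ceThreshold T (T - m) b ∈ Metric.ball _ _ ↔ _
    rw [Metric.mem_ball, Real.dist_eq, hce, hcast, gapRadius]
  rcases hp (T - m) b with ⟨hempty, hpe⟩ | ⟨j, hj, hmin, hpe⟩
  · refine Or.inl ⟨fun i => ?_, hpe.trans hce⟩
    rw [← not_lt, ← hmem, hempty]
    exact notMem_empty i
  · rw [hce] at hmin
    have hj' := (hmem j).1 hj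
    refine Or.inr ⟨j, hj', fun i => ?_, hpe⟩
    by_cases hi : i ∈ nearGaps T q (T - m) b
    · exact hmin i hi
    · rw [hmem, not_lt] at hi
      exact hj'.le.trans hi

end Loss

/-! ### CwG along a path -/

section PathLevel

variable {μ : Measure ℝ} {T : ℕ}

lemma budget_succ_of_lt (B : ℕ) (P : ℕ → ℕ → ℝ) (ω : Path T) {s : ℕ} (h : s < T) :
    budget μ B P ω (s + 1) =
      if P s (budget μ B P ω s) ≤ quantileSample μ (ω ⟨s, h⟩) ∧ 0 < budget μ B P ω s then
        budget μ B P ω s - 1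
      else budget μ B P ω s := by
  rw [budget, dif_pos h]

lemma budget_congr (B : ℕ) {P Q : ℕ → ℕ → ℝ} (ω : Path T) {s : ℕ}
    (h : ∀ i < s, P i = Q i) : budget μ B P ω s = budget μ B Q ω s := by
  induction s with
  | zero => rfl
  | succ s ih =>
    have := ih fun i hi => h i (by omega)
    simp only [budget, this, h s (Nat.lt_succ_self s)]

variable {B : ℕ} {ε₀ : ℝ} {p : ℕ → ℕ → ℝ}

/-- The path continued by an arbitrary value. -/
def extend (ω : Path T) (s : ℕ) : ℝ × ℝ := if h : s < T then ω ⟨s, h⟩ else 0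

/-- The ability hired after `s` elapsed periods. -/
def hiredAbility (μ : Measure ℝ) (B : ℕ) (ε₀ : ℝ) (p : ℕ → ℕ → ℝ) (ω : Path T) (s : ℕ) : ℝ :=
  if h : s < T then (cwg μ T B ε₀ p ⟨s, h⟩).indicator (fun ω' => (ω' ⟨s, h⟩).1) ω else 0

open Classical in
lemma hiredAbility_eq (ω : Path T) {s : ℕ} (h : s < T) :
    hiredAbility μ B ε₀ p ω s =
      if cwgThreshold μ B ε₀ p ω s (budget μ B (cwgThreshold μ B ε₀ p ω) ω s)
          ≤ quantileSample μ (extend ω s) ∧ 0 < budget μ B (cwgThreshold μ B ε₀ p ω) ω s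
      then (extend ω s).1 else 0 := by
  rw [hiredAbility, dif_pos h, extend, dif_pos h, indicator_apply]
  exact if_congr Iff.rfl rfl rfl

lemma twoPhaseValue_succ {Ω : Type*} {θ X : Ω → ℝ} {m₀ m : ℕ} (h : ¬ m + 1 ≤ m₀)
    (p : ℕ → ℕ → ℝ) (b : ℕ) (ω : Fin (m + 1) → Ω) :
    twoPhaseValue θ X m₀ p (m + 1) b ω = if p (m + 1) b ≤ X (ω 0) ∧ 0 < b then
      θ (ω 0) + twoPhaseValue θ X m₀ p m (b - 1) (Fin.tail ω)
    else twoPhaseValue θ X m₀ p m b (Fin.tail ω) := by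
  rw [twoPhaseValue, if_neg h]

lemma tail_extend (ω : Path T) (s m : ℕ) :
    Fin.tail (fun i : Fin (m + 1) => extend ω (s + i)) = fun i : Fin m => extend ω (s + 1 + i) := by
  ext1 i
  simp only [Fin.tail, Fin.val_succ]
  congr 1; omega

lemma sum_range_hiredAbility (ω : Path T) (s m : ℕ) :
    ∑ i ∈ Finset.range (m + 1), hiredAbility μ B ε₀ p ω (s + i)
      = hiredAbility μ B ε₀ p ω s
        + ∑ i ∈ Finset.range m, hiredAbility μ B ε₀ p ω (s + 1 + i) := by
  rw [Finset.sum_range_succ', add_comm]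
  congr 1
  refine Finset.sum_congr rfl fun i _ => ?_
  congr 1; omega

/-- The policy runs forward in elapsed time `s`, the value recursion in the number `m = T - s` of
candidates left. Indexing by `ℕ` through `extend` makes dropping a candidate a mere shift of `s`. -/
lemma sum_hiredAbility_eq_staticValue (ω : Path T) (m : ℕ) : ∀ s, s + m = T →
    firstPhase T ε₀ ≤ s →
    ∑ i ∈ Finset.range m, hiredAbility μ B ε₀ p ω (s + i)
      = staticValue Prod.fst (quantileSample μ)
          (ceThreshold T (firstPhase T ε₀) (budget μ B p ω (firstPhase T ε₀))) m
          (budget μ B (cwgThreshold μ B ε₀ p ω) ω s) (fun i : Fin m => extend ω (s + i)) := by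
  induction m with
  | zero => intro s _ _; simp [staticValue]
  | succ m ih =>
    intro s hs hfp
    have hlt : s < T := by omega
    rw [sum_range_hiredAbility, hiredAbility_eq ω hlt, ih (s + 1) (by omega) (by omega),
      staticValue, tail_extend, budget_succ_of_lt _ _ _ hlt]
    have hthr : ∀ b, cwgThreshold μ B ε₀ p ω s b
        = ceThreshold T (firstPhase T ε₀) (budget μ B p ω (firstPhase T ε₀)) := fun b => by
      rw [cwgThreshold, if_neg (by omega)]
    have hext : ω ⟨s, hlt⟩ = extend ω s := by rw [extend, dif_pos hlt]
    simp only [hthr, hext, Fin.val_zero, add_zero]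
    split_ifs
    · rfl
    · rw [zero_add]

lemma sum_hiredAbility_eq_twoPhaseValue (ω : Path T) (m : ℕ) : ∀ s, s + m = T →
    s ≤ firstPhase T ε₀ →
    ∑ i ∈ Finset.range m, hiredAbility μ B ε₀ p ω (s + i)
      = twoPhaseValue Prod.fst (quantileSample μ) (T - firstPhase T ε₀) (fun j b => p (T - j) b) m
          (budget μ B (cwgThreshold μ B ε₀ p ω) ω s) (fun i : Fin m => extend ω (s + i)) := by
  have hfpT : firstPhase T ε₀ ≤ T := Nat.sub_le _ _
  induction m with
  | zero => intro s _ _; simp [twoPhaseValue]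
  | succ m ih =>
    intro s hs hfp
    have hlt : s < T := by omega
    rcases hfp.eq_or_lt with heq | hlt'
    · rw [sum_hiredAbility_eq_staticValue ω (m + 1) s hs heq.ge, twoPhaseValue, if_pos (by omega)]
      congr 1
      -- The frozen threshold is defined through the budget generated by `p` alone, which agrees
      -- with the true budget up to the end of the first phase.
      have hb : budget μ B (cwgThreshold μ B ε₀ p ω) ω s = budget μ B p ω (firstPhase T ε₀) := by
        rw [heq]
        refine budget_congr B ω fun i hi => ?_
        ext b
        rw [cwgThreshold, if_pos hi]
      rw [hb, ceThreshold]
      have : (T : ℝ) - firstPhase T ε₀ = ((m + 1 : ℕ) : ℝ) := by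
        rw [← heq, ← hs]; push_cast; ring
      rw [this]
    · rw [sum_range_hiredAbility, hiredAbility_eq ω hlt, ih (s + 1) (by omega) (by omega),
        twoPhaseValue_succ (show ¬ m + 1 ≤ T - firstPhase T ε₀ by omega), tail_extend,
        budget_succ_of_lt _ _ _ hlt]
      have hthr : ∀ b, cwgThreshold μ B ε₀ p ω s b = p (T - (m + 1)) b := fun b => by
        rw [cwgThreshold, if_pos hlt']
        congr 1; omega
      have hext : ω ⟨s, hlt⟩ = extend ω s := by rw [extend, dif_pos hlt]
      simp only [hthr, hext, Fin.val_zero, add_zero]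
      split_ifs
      · rfl
      · rw [zero_add]

/-- The ability hired by CwG as the value of a two-phase policy. -/
lemma sum_indicator_cwg (ω : Path T) :
    ∑ t : Fin T, (cwg μ T B ε₀ p t).indicator (fun ω' => (ω' t).1) ω
      = twoPhaseValue Prod.fst (quantileSample μ) (T - firstPhase T ε₀) (fun j b => p (T - j) b)
          T B ω := by
  have h := sum_hiredAbility_eq_twoPhaseValue (μ := μ) (B := B) (ε₀ := ε₀) (p := p) ω T 0
    (zero_add T) (Nat.zero_le _)
  have hω : (fun i : Fin T => extend ω (0 + i)) = ω := by
    ext1 i; rw [zero_add, extend, dif_pos i.2]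
  rw [hω, budget] at h
  rw [← h, ← Fin.sum_univ_eq_sum_range (fun i => hiredAbility μ B ε₀ p ω (0 + i))]
  refine Finset.sum_congr rfl fun t _ => ?_
  rw [zero_add, hiredAbility, dif_pos t.2]

lemma ncard_hired_le (ω : Path T) : {t : Fin T | ω ∈ cwg μ T B ε₀ p t}.ncard ≤ B := by
  classical
  set P := cwgThreshold μ B ε₀ p ω
  set g : ℕ → ℕ := fun s => if h : s < T then (if ω ∈ cwg μ T B ε₀ p ⟨s, h⟩ then 1 else 0) else 0
  -- Hires so far plus remaining budget is invariant; feasibility thus holds on every path.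
  have key : ∀ s ≤ T, ∑ i ∈ Finset.range s, g i + budget μ B P ω s = B := by
    intro s
    induction s with
    | zero => intro _; simp [budget]
    | succ s ih =>
      intro hs
      have hlt : s < T := by omega
      have := ih hlt.le
      rw [Finset.sum_range_succ, budget_succ_of_lt _ _ _ hlt]
      have hg : g s = if ω ∈ cwg μ T B ε₀ p ⟨s, hlt⟩ then 1 else 0 := dif_pos hlt
      have hiff : ω ∈ cwg μ T B ε₀ p ⟨s, hlt⟩ ↔
        (P s (budget μ B P ω s) ≤ quantileSample μ (ω ⟨s, hlt⟩) ∧ 0 < budget μ B P ω s) := Iff.rfl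
      rw [hg, hiff]
      split_ifs with h
      · have hpos := h.2
        omega
      · omega
  have hT := key T le_rfl
  rw [← Fin.sum_univ_eq_sum_range] at hT
  rw [ncard_eq_toFinset_card']
  have : ({t : Fin T | ω ∈ cwg μ T B ε₀ p t}.toFinset).card = ∑ i : Fin T, g i := by
    simp only [g, Fin.is_lt, dif_pos, Fin.eta]
    rw [Finset.sum_ite]
    simp
  omega

lemma measurable_apply_nat {Ω : Type*} [MeasurableSpace Ω] {F : Ω → ℕ → ℝ} {g : Ω → ℕ}
    (hF : ∀ b, Measurable fun x => F x b) (hg : Measurable g) : Measurable fun x => F x (g x) :=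
  (measurable_from_prod_countable_left (f := fun z : Ω × ℕ => F z.1 z.2) hF).comp
    (measurable_id.prodMk hg)

/-- Budgets are measurable with respect to the candidates met so far. -/
lemma measurable_budget {Ω : Type*} [MeasurableSpace Ω] (hX : Measurable (quantileSample μ))
    (f : Ω → Path T) (P : Ω → ℕ → ℕ → ℝ) {s : ℕ}
    (hf : ∀ i : Fin T, (i : ℕ) < s → Measurable fun x => f x i)
    (hP : ∀ i < s, ∀ b, Measurable fun x => P x i b) :
    Measurable fun x => budget μ B (P x) (f x) s := by
  induction s with
  | zero => exact measurable_const
  | succ s ih =>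
    have hb := ih (fun i hi => hf i (by omega)) fun i hi => hP i (by omega)
    by_cases h : s < T
    · simp_rw [budget_succ_of_lt B _ _ h]
      have hthr : Measurable fun x => P x s (budget μ B (P x) (f x) s) :=
        measurable_apply_nat (F := fun x => P x s) (hP s (Nat.lt_succ_self s)) hb
      refine Measurable.ite ?_ (hb.sub_const 1) hb
      exact (measurableSet_le hthr (hX.comp (hf ⟨s, h⟩ (Nat.lt_succ_self s)))).inter
        (measurableSet_lt measurable_const hb)
    · simp only [budget, dif_neg h]
      exact hb

lemma measurable_cwgThreshold {Ω : Type*} [MeasurableSpace Ω]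
    (hX : Measurable (quantileSample μ)) (f : Ω → Path T) {s : ℕ}
    (hf : ∀ i : Fin T, (i : ℕ) < s → Measurable fun x => f x i) (b : ℕ) :
    Measurable fun x => cwgThreshold μ B ε₀ p (f x) s b := by
  by_cases h : s < firstPhase T ε₀
  · simp only [cwgThreshold, if_pos h]; exact measurable_const
  · simp only [cwgThreshold, if_neg h]
    have hb := measurable_budget (B := B) hX f (fun _ => p) (s := firstPhase T ε₀)
      (fun j hj => hf j (by omega)) fun _ _ _ => measurable_const
    exact (measurable_from_nat (f := ceThreshold T (firstPhase T ε₀))).comp hb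

/-- The domain is left general so that the identity of the path space can be used with the coarser
σ-algebra of the filtration as its source. -/
lemma measurableSet_cwg {Ω : Type*} [MeasurableSpace Ω] (hX : Measurable (quantileSample μ))
    (f : Ω → Path T) (t : Fin T) (hf : ∀ i ≤ t, Measurable fun x => f x i) :
    MeasurableSet (f ⁻¹' cwg μ T B ε₀ p t) := by
  have hf' : ∀ s ≤ (t : ℕ), ∀ i : Fin T, (i : ℕ) < s → Measurable fun x => f x i :=
    fun s hs i hi => hf i (Fin.le_def.2 (by omega))
  have hthr : ∀ s ≤ (t : ℕ), ∀ b, Measurable fun x => cwgThreshold μ B ε₀ p (f x) s b :=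
    fun s hs b => measurable_cwgThreshold hX f (hf' s hs) b
  have hb : Measurable fun x => budget μ B (cwgThreshold μ B ε₀ p (f x)) (f x) t :=
    measurable_budget hX f (fun x => cwgThreshold μ B ε₀ p (f x)) (hf' t le_rfl)
      fun i hi => hthr i hi.le
  have hval : Measurable fun x => cwgThreshold μ B ε₀ p (f x) t
      (budget μ B (cwgThreshold μ B ε₀ p (f x)) (f x) t) :=
    measurable_apply_nat (F := fun x => cwgThreshold μ B ε₀ p (f x) t) (hthr t le_rfl) hb
  exact (measurableSet_le hval (hX.comp (hf t le_rfl))).inter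
    (measurableSet_lt measurable_const hb)

lemma isFeasibleOnline_cwg (hX : Measurable (quantileSample μ)) :
    IsFeasibleOnline μ B (cwg μ T B ε₀ p) where
  online t := by
    refine @measurableSet_cwg μ T B ε₀ p _ (Filtration.piLE (X := fun _ : Fin T => ℝ × ℝ) t) hX
      id t fun i hi => ?_
    exact (measurable_pi_apply (X := fun _ : Iic t => ℝ × ℝ) (⟨i, hi⟩ : Iic t)).comp
      (comap_measurable _)
  feasible := Filter.Eventually.of_forall ncard_hired_le

end PathLevel

/-! ### The regret bound -/

section Regret

variable {μ : Measure ℝ} [IsProbabilityMeasure μ]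

lemma regret_cwg_eq (hμ : μ (Icc (0 : ℝ) 1)ᶜ = 0) (T B : ℕ) (ε₀ : ℝ) (p : ℕ → ℕ → ℝ) :
    regret μ B (cwg μ T B ε₀ p)
      = ∫ ω, valueGap Prod.fst (quantileSample μ) (T - firstPhase T ε₀)
          (fun j b => p (T - j) b) T B ω ∂(Measure.pi fun _ : Fin T => candidate μ) := by
  have hc := isQuantileCoupling_candidate hμ
  have hoff : Integrable (fun ω : Path T => offlineValue B fun t => (ω t).1)
      (Measure.pi fun _ : Fin T => candidate μ) := by
    refine (integrable_const (T : ℝ)).mono' ((measurable_offlineValue B).comp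
      (measurable_pi_lambda _ fun i => measurable_fst.comp
        (measurable_pi_apply i))).aestronglyMeasurable ?_
    filter_upwards [ae_forall_pi hc.ae_ability_mem T] with ω hω
    refine (abs_offlineValue_le B _).trans ?_
    calc ∑ i, |(ω i).1| ≤ ∑ _i : Fin T, (1 : ℝ) := Finset.sum_le_sum fun i _ => by
          rw [abs_of_nonneg (hω i).1]; exact (hω i).2
      _ = T := by simp
  have hgap := hc.integrable_valueGap (m₀ := T - firstPhase T ε₀)
    (p := fun j b => p (T - j) b) T B
  have hon : Integrable (fun ω : Path T => twoPhaseValue Prod.fst (quantileSample μ)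
      (T - firstPhase T ε₀) (fun j b => p (T - j) b) T B ω)
      (Measure.pi fun _ : Fin T => candidate μ) := by
    refine (hoff.sub hgap).congr (Filter.Eventually.of_forall fun ω => ?_)
    simp [valueGap]
  unfold regret pathMeasure
  simp_rw [sum_indicator_cwg]
  rw [← integral_sub hoff hon]
  rfl

/-- The regret of CwG. -/
lemma regret_cwg_le {β ε₀ δ : ℝ} (hβ : 0 ≤ β) (hε : 0 < ε₀) (hε1 : ε₀ ≤ 1) (hδ : 0 ≤ δ)
    (hμ : μ (Icc (0 : ℝ) 1)ᶜ = 0) {n : ℕ} {q : Fin (n + 2) → ℝ}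
    (hq : IsClusteredWith μ β ε₀ δ q) {T B : ℕ} (hT : 1 ≤ T) (hBT : B ≤ T) {p : ℕ → ℕ → ℝ}
    (hp : IsCwGThreshold T q p) :
    regret μ B (cwg μ T B ε₀ p) ≤
      (if 0 < β then
        16 * (1 + 1 / β) * Real.log T ^ (1 / 2 + 1 / (2 * (β + 1)))
          * (T : ℝ) ^ (1 / 2 - 1 / (2 * (1 + β)))
      else 0) + 16 * Real.log T ^ 2 + 16 * δ * Real.sqrt (T * Real.log T)
        + 16 * (Real.sqrt (Real.log (1 / ε₀)) / ε₀) := by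
  set L := Real.log (1 / ε₀) with hLdef
  have hL : 0 ≤ L := Real.log_nonneg (by rw [le_div_iff₀ hε]; linarith)
  set j := firstPhase T ε₀ with hj
  set m₀ := T - j with hm₀
  have hjT : j ≤ T := Nat.sub_le _ _
  have hmj : m₀ + j = T := by omega
  have hm₀le : (m₀ : ℝ) ≤ 16 * L / ε₀ ^ 2 := by
    have h1 : m₀ ≤ ⌊16 * L / ε₀ ^ 2⌋₊ := by
      rw [hm₀, hj, firstPhase, ← hLdef]; omega
    exact (Nat.cast_le.2 h1).trans (Nat.floor_le (by positivity))
  have hlarge : ∀ k, m₀ ≤ k → k < T → 16 * L / ε₀ ^ 2 < ((k + 1 : ℕ) : ℝ) := by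
    intro k hk hkT
    refine Nat.lt_of_floor_lt ?_
    -- Since `m₀ ≤ k < T`, the minimum is not `T`, so the floor is at most `k`.
    have : m₀ = min T ⌊16 * L / ε₀ ^ 2⌋₊ := by
      rw [hm₀, hj, firstPhase, ← hLdef]; omega
    omega
  have hc := isQuantileCoupling_candidate hμ
  have hlog : 0 ≤ Real.log T := Real.log_natCast_nonneg T
  have key := hc.integral_valueGap_le_sum (m₀ := m₀) (p := fun j b => p (T - j) b)
    (lossBound (1 / 2 + 1 / (2 * (β + 1))) δ (Real.log T)) j
    (fun k => lossBound_nonneg hδ hlog k)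
    (fun k hk hkj => valueGap_step hc hq hβ hδ hk (T := T) (p := fun j b => p (T - j) b) (by omega)
      (fun b => isGapConservative_of_isCwGThreshold hp (by omega) b)
      (fun i => gapRadius_lt hε (hq.le_half i) (hlarge k hk (by omega))))
    (b := B) (by omega)
  rw [hmj] at key
  rw [regret_cwg_eq hμ]
  refine key.trans ?_
  have hsqrt : Real.sqrt m₀ ≤ 16 * (Real.sqrt L / ε₀) := by
    have h4 : Real.sqrt (16 * L / ε₀ ^ 2) = 4 * (Real.sqrt L / ε₀) := by
      rw [Real.sqrt_div (by positivity), Real.sqrt_sq hε.le, Real.sqrt_mul (by norm_num),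
        show (16 : ℝ) = 4 ^ 2 by norm_num, Real.sqrt_sq (by norm_num)]
      ring
    have h0 : 0 ≤ Real.sqrt L / ε₀ := by positivity
    have := Real.sqrt_le_sqrt hm₀le
    rw [h4] at this
    linarith
  -- The first phase contributes only the indices from `m₀` to `T - 1`; the nonnegative earlier
  -- terms are added so that the bound depends on `T` alone.
  have hsum : ∑ i ∈ Finset.range j, lossBound (1 / 2 + 1 / (2 * (β + 1))) δ (Real.log T) (m₀ + i)
      ≤ ∑ k ∈ Finset.range T, lossBound (1 / 2 + 1 / (2 * (β + 1))) δ (Real.log T) k := by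
    rw [← hmj, Finset.sum_range_add, hmj]
    exact le_add_of_nonneg_left (Finset.sum_nonneg fun k _ => lossBound_nonneg hδ hlog k)
  have := sum_lossBound_le hβ hδ hT
  linarith

end Regret

end

end MultiSecretary

theorem theorem4 :
    ∃ C : ℝ, ∀ (β ε₀ δ : ℝ), 0 ≤ β → 0 < ε₀ → ε₀ ≤ 1 → 0 ≤ δ → δ ≤ 1 →
      ∀ (μ : MeasureTheory.Measure ℝ), MeasureTheory.IsProbabilityMeasure μ →
      μ (Set.Icc (0 : ℝ) 1)ᶜ = 0 →
      ∀ (n : ℕ) (q : Fin (n + 2) → ℝ), MultiSecretary.IsClusteredWith μ β ε₀ δ q →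
      ∀ (T B : ℕ), 1 ≤ B → B ≤ T →
      ∀ (p : ℕ → ℕ → ℝ), MultiSecretary.IsCwGThreshold T q p →
        MultiSecretary.IsFeasibleOnline μ B (MultiSecretary.cwg μ T B ε₀ p) ∧
        MultiSecretary.regret μ B (MultiSecretary.cwg μ T B ε₀ p) ≤
          (if 0 < β then
            C * (1 + 1 / β) * Real.log T ^ (1 / 2 + 1 / (2 * (β + 1)))
              * (T : ℝ) ^ (1 / 2 - 1 / (2 * (1 + β)))
          else 0)
          + C * Real.log T ^ 2
          + C * δ * Real.sqrt (T * Real.log T)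
          + C * (Real.sqrt (Real.log (1 / ε₀)) / ε₀) := by
  refine ⟨16, ?_⟩
  intro β ε₀ δ hβ hε hε1 hδ _ μ hprob hμ n q hq T B hB hBT p hp
  exact ⟨MultiSecretary.isFeasibleOnline_cwg (MultiSecretary.measurable_quantileSample hμ),
    MultiSecretary.regret_cwg_le hβ hε hε1 hδ hμ hq (hB.trans hBT) hBT hp⟩
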